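/- Let $p\in\mathbb N$, $q\in\{1,2\}$, $M>0$, and $\mathcal B=\{\beta\in\mathbb R^p:\beta\ge 0,\ \|\beta\|_\infty\le M\}$. Let $\mu$ be a finite measure on $\mathbb R_+=[0,\infty)$ with $\mu((0,\infty))>0$ whose support is bounded and bounded away from zero. Put $h(z)=\int_0^\infty e^{-tz}\,\mu(dt)$, and let $\mathcal H$ be the reproducing kernel Hilbert space of real functions on $\mathbb R^p$ with kernel $k(x,x')=h(\|x-x'\|_q^q)$. Let $Q$ be a probability law of $(X,Y)\in\mathbb R^p\times\mathbb R$ with bounded support such that $\mathbb E_Q[Y]=0$ and $\mathrm{Var}_Q(X_l)>0$ for all $l\in[p]$. The signal set $S\subseteq[p]$ is the minimal set such that $\mathbb E_Q[Y|X]=\mathbb E_Q[Y|X_S]$ and $X_S\perp X_{S^c}$ under $Q$. Assume $S\ne\emptyset$. For $\lambda>0$ and $\beta\ge 0$ define $$F_\lambda^{\rm KRR}(\beta)=\min_{f\in\mathcal H}\ \tfrac12\,\mathbb E_Q\big[(Y-f(\beta^{1/q}\odot X))^2\big]+\tfrac{\lambda}{2}\|f\|_{\mathcal H}^2,$$ where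 $\beta^{1/q}\odot X$ is the vector with coordinates $\beta_i^{1/q}X_i$. A locally Lipschitz function $F$ on $\mathcal B$ is called self-penalizing with respect to a relatively open set $B\subseteq\mathcal B$ if 1. $F$ is differentiable on a subset $B^0$ that is dense in $B$, and there is $\kappa>0$ with $\mathrm{sign}(\beta_j)\,\partial_{\beta_j}F(\beta)\ge\kappa$ for all $j\notin S$ and all $\beta\in B^0$; and 2. $B$ contains a stationary point $\beta$ with $\mathrm{supp}(\beta)\subseteq S$, where stationary means $\beta \in \mathcal B$ and $0\in\partial F(\beta)+N_{\mathcal B}(\beta)$, with $\partial F$ the Clarke subdifferential of $F$ on $\mathcal B$ (the convex hull of the limits of gradients of $F$ at points of differentiability in the interior of $\mathcal B$ converging to $\beta$; the gradient, if $F$ is continuously differentiable on $\mathcal B$) and $N_{\mathcal B}$ the normal cone of $\mathcal B$. For $c,\delta,\lambda>0$ let $$B_{c,\delta,\lambda}=\Big\{\beta\in\mathcal B:\ F^{\rm KRR}_\lambda(0)-F^{\rm KRR}_\lambda(\beta)>c,\ \ \|\beta_{S^c}\|_1<\delta c^2\lambda^3\Big\}.$$ Then: (a) There are $c_0,\lambda_0>0$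 such that $B_{c,\delta,\lambda}\ne\emptyset$ for all $0<c\le c_0$, $0<\lambda\le\lambda_0$ and $\delta>0$. (b) There is $\delta_0>0$ such that for all $c>0$, $0<\delta\le\delta_0$ and $0<\lambda\le 1$ with $B_{c,\delta,\lambda}\neq\emptyset$, the objective $F^{\rm KRR}_\lambda$ is self-penalizing with respect to $B_{c,\delta,\lambda}$. -/

import Mathlib

open MeasureTheory ProbabilityTheory Filter Topology
open scoped NNReal Pointwise

namespace SelfPen

/-! ### The `ℓ_q`-type kernel and its reproducing kernel Hilbert space -/

/-- The function `h(z) = ∫_0^∞ e^{-tz} μ(dt)` attached to a finite measure `μ` on `ℝ₊`. -/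
noncomputable def laplaceFun (μ : Measure ℝ≥0) (z : ℝ) : ℝ :=
  ∫ t : ℝ≥0, Real.exp (-((t : ℝ) * z)) ∂μ

/-- The kernel `k(x, x') = h(‖x - x'‖_q ^ q)` on `ℝ^p`, as a matrix of (scalar) operators. -/
noncomputable def kernelMatrix (μ : Measure ℝ≥0) (q p : ℕ) :
    Matrix (Fin p → ℝ) (Fin p → ℝ) (ℝ →L[ℝ] ℝ) :=
  Matrix.of fun x y => laplaceFun μ (∑ i, |x i - y i| ^ q) • ContinuousLinearMap.id ℝ ℝ

theorem posSemidef_integral {X α : Type*} [MeasurableSpace α] (ν : Measure α)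
    (M : α → Matrix X X ℝ) (hM : ∀ a, (M a).PosSemidef)
    (hint : ∀ x y, Integrable (fun a => M a x y) ν) :
    (Matrix.of fun x y => ∫ a, M a x y ∂ν : Matrix X X ℝ).PosSemidef := by
  refine ⟨?_, fun c => ?_⟩
  · ext x y
    simp only [Matrix.conjTranspose_apply, Matrix.of_apply, star_trivial]
    exact integral_congr_ae (.of_forall fun a => by simpa using (hM a).1.apply x y)
  · have h : (c.sum fun i xi => c.sum fun j xj =>
        star xi * (Matrix.of fun x y => ∫ a, M a x y ∂ν : Matrix X X ℝ) i j * xj)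
        = ∫ a, (c.sum fun i xi => c.sum fun j xj => star xi * M a i j * xj) ∂ν := by
      simp only [Finsupp.sum, Matrix.of_apply]
      rw [integral_finsetSum]
      · refine Finset.sum_congr rfl fun i _ => ?_
        rw [integral_finsetSum]
        · refine Finset.sum_congr rfl fun j _ => ?_
          rw [integral_mul_const, integral_const_mul]
        · exact fun j _ => ((hint i j).const_mul _).mul_const _
      · exact fun i _ => integrable_finsetSum _ fun j _ =>
          ((hint i j).const_mul _).mul_const _
    rw [h]
    exact integral_nonneg fun a => (hM a).2 c

theorem posSemidef_rankOne {X : Type*} (φ : X → ℝ) :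
    (Matrix.of fun x y => φ x * φ y : Matrix X X ℝ).PosSemidef := by
  refine ⟨?_, fun c => ?_⟩
  · ext x y
    simp [mul_comm]
  · have h : (c.sum fun i xi => c.sum fun j xj =>
        star xi * (Matrix.of fun x y => φ x * φ y : Matrix X X ℝ) i j * xj)
        = (c.sum fun i xi => xi * φ i) ^ 2 := by
      simp only [Finsupp.sum, Matrix.of_apply, star_trivial, sq, Finset.sum_mul_sum]
      refine Finset.sum_congr rfl fun i _ => Finset.sum_congr rfl fun j _ => ?_
      ring
    rw [h]
    positivity

theorem posSemidef_exp_abs (t : ℝ) (ht : 0 ≤ t) :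
    (Matrix.of fun x y : ℝ => Real.exp (-(t * |x - y|)) : Matrix ℝ ℝ ℝ).PosSemidef := by
  set φ : ℝ → ℝ → ℝ := fun u x =>
    Real.exp (-(t * x)) * (Set.Ioc 0 (Real.exp (2 * t * x))).indicator (fun _ => (1 : ℝ)) u with hφ
  have hmul : ∀ x y u, φ u x * φ u y = (Real.exp (-(t * x)) * Real.exp (-(t * y))) *
      (Set.Ioc 0 (min (Real.exp (2 * t * x)) (Real.exp (2 * t * y)))).indicator
        (fun _ => (1 : ℝ)) u := by
    intro x y u
    have : Set.Ioc 0 (min (Real.exp (2 * t * x)) (Real.exp (2 * t * y)))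
        = Set.Ioc 0 (Real.exp (2 * t * x)) ∩ Set.Ioc 0 (Real.exp (2 * t * y)) := by
      rw [Set.Ioc_inter_Ioc]; simp
    rw [this]
    simp only [hφ, Set.indicator_apply, Set.mem_inter_iff]
    split_ifs <;> simp_all
  have key := posSemidef_integral (volume : Measure ℝ)
    (fun u => (Matrix.of fun x y => φ u x * φ u y : Matrix ℝ ℝ ℝ))
    (fun u => posSemidef_rankOne (φ u)) (fun x y => by
      simp only [Matrix.of_apply, hmul]
      refine Integrable.const_mul ?_ _
      refine (integrable_indicator_iff measurableSet_Ioc).2 ?_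
      simp)
  convert key using 1
  ext x y
  simp only [Matrix.of_apply, hmul]
  rw [integral_const_mul, integral_indicator measurableSet_Ioc]
  simp only [integral_const, smul_eq_mul, mul_one, MeasurableSet.univ, measureReal_restrict_apply,
    Set.univ_inter]
  rw [Real.volume_real_Ioc_of_le (by positivity), sub_zero, ← Real.exp_monotone.map_min,
    ← Real.exp_add, ← Real.exp_add]
  congr 1
  rcases le_total x y with hxy | hxy
  · rw [abs_of_nonpos (by linarith), min_eq_left (by nlinarith)]; ring
  · rw [abs_of_nonneg (by linarith), min_eq_right (by nlinarith)]; ring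

theorem posSemidef_exp_sq (t : ℝ) (ht : 0 ≤ t) :
    (Matrix.of fun x y : ℝ => Real.exp (-(t * |x - y| ^ 2)) : Matrix ℝ ℝ ℝ).PosSemidef := by
  rcases ht.eq_or_lt with rfl | ht
  · simpa using posSemidef_rankOne (fun _ : ℝ => (1 : ℝ))
  set κ : ℝ := (√(Real.pi / (4 * t)))⁻¹ with hκ
  have hκ0 : √(Real.pi / (4 * t)) ≠ 0 := by positivity
  set φ : ℝ → ℝ → ℝ := fun u x => √κ * Real.exp (-(2 * t * (x - u) ^ 2)) with hφ
  have hmul : ∀ x y u, φ u x * φ u y = (κ * Real.exp (-(t * |x - y| ^ 2))) *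
      Real.exp (-(4 * t) * (u - (x + y) / 2) ^ 2) := by
    intro x y u
    have : φ u x * φ u y = (√κ * √κ) *
      (Real.exp (-(2 * t * (x - u) ^ 2)) * Real.exp (-(2 * t * (y - u) ^ 2))) := by
      simp only [hφ]; ring
    rw [this, Real.mul_self_sqrt (by positivity), mul_assoc κ, ← Real.exp_add, ← Real.exp_add,
      sq_abs]
    congr 2
    ring
  have key := posSemidef_integral (volume : Measure ℝ)
    (fun u => (Matrix.of fun x y => φ u x * φ u y : Matrix ℝ ℝ ℝ))
    (fun u => posSemidef_rankOne (φ u)) (fun x y => by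
      simp only [Matrix.of_apply, hmul]
      refine Integrable.const_mul ?_ _
      exact (integrable_exp_neg_mul_sq (b := 4 * t) (by positivity)).comp_sub_right ((x + y) / 2))
  convert key using 1
  ext x y
  simp only [Matrix.of_apply, hmul]
  rw [integral_const_mul,
    integral_sub_right_eq_self (fun u => Real.exp (-(4 * t) * u ^ 2)) ((x + y) / 2),
    integral_gaussian, hκ]
  field_simp

theorem posSemidef_exp_sum (q p : ℕ) (hq : q = 1 ∨ q = 2) (t : ℝ) (ht : 0 ≤ t)
    (s : Finset (Fin p)) :
    (Matrix.of fun x y : Fin p → ℝ => Real.exp (-(t * ∑ i ∈ s, |x i - y i| ^ q)) :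
      Matrix _ _ ℝ).PosSemidef := by
  classical
  induction s using Finset.induction_on with
  | empty => simpa using posSemidef_rankOne (fun _ : Fin p → ℝ => (1 : ℝ))
  | insert i s his ih =>
    have h1 : (Matrix.of fun x y : ℝ => Real.exp (-(t * |x - y| ^ q)) : Matrix ℝ ℝ ℝ).PosSemidef := by
      rcases hq with rfl | rfl
      · simpa using posSemidef_exp_abs t ht
      · exact posSemidef_exp_sq t ht
    have h2 := (h1.submatrix (fun x : Fin p → ℝ => x i)).hadamard ih
    have h3 : (Matrix.of fun x y : Fin p → ℝ =>
        Real.exp (-(t * ∑ j ∈ insert i s, |x j - y j| ^ q)) : Matrix _ _ ℝ)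
        = Matrix.hadamard
          ((Matrix.of fun x y : ℝ => Real.exp (-(t * |x - y| ^ q)) : Matrix ℝ ℝ ℝ).submatrix
            (fun x : Fin p → ℝ => x i) (fun x : Fin p → ℝ => x i))
          (Matrix.of fun x y : Fin p → ℝ => Real.exp (-(t * ∑ j ∈ s, |x j - y j| ^ q))) := by
      ext x y
      rw [Matrix.hadamard_apply, Matrix.submatrix_apply, Matrix.of_apply, Matrix.of_apply,
        Matrix.of_apply, Finset.sum_insert his, ← Real.exp_add]
      congr 1
      ring
    rw [h3]
    exact h2

theorem posSemidef_laplaceFun (μ : Measure ℝ≥0) [IsFiniteMeasure μ] (q p : ℕ)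
    (hq : q = 1 ∨ q = 2) :
    (Matrix.of fun x y : Fin p → ℝ => laplaceFun μ (∑ i, |x i - y i| ^ q) :
      Matrix _ _ ℝ).PosSemidef := by
  refine posSemidef_integral μ
    (fun t => (Matrix.of fun x y : Fin p → ℝ =>
      Real.exp (-((t : ℝ) * ∑ i, |x i - y i| ^ q)) : Matrix _ _ ℝ))
    (fun t => posSemidef_exp_sum q p hq t t.2 Finset.univ) (fun x y => ?_)
  refine Integrable.of_bound (C := 1) ?_ (.of_forall fun t => ?_)
  · simp only [Matrix.of_apply]
    exact (by fun_prop : Measurable fun t : ℝ≥0 =>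
      Real.exp (-((t : ℝ) * ∑ i, |x i - y i| ^ q))).aestronglyMeasurable
  · simp only [Matrix.of_apply, Real.norm_eq_abs, Real.abs_exp, Real.exp_le_one_iff,
      Left.neg_nonpos_iff]
    positivity

/-- The kernel is positive semidefinite, so that it has a reproducing kernel Hilbert space. -/
instance kernelMatrix_posSemidef (μ : Measure ℝ≥0) [IsFiniteMeasure μ] (q p : ℕ)
    [hq : Fact (q = 1 ∨ q = 2)] : Fact (kernelMatrix μ q p).PosSemidef := by
  have htfae := (RKHS.posSemidef_tfae (𝕜 := ℝ) (K := kernelMatrix μ q p)).out 0 2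
  refine ⟨htfae.2 ⟨?_, fun v => ?_⟩⟩
  · ext x y
    have h1 : star (ContinuousLinearMap.id ℝ ℝ) = ContinuousLinearMap.id ℝ ℝ :=
      star_one (ℝ →L[ℝ] ℝ)
    simp [kernelMatrix, Matrix.conjTranspose_apply, abs_sub_comm, h1]
  · have h := (posSemidef_laplaceFun μ q p hq.out).2 v
    have h2 : ∀ a b : ℝ, 0 ≤ a → a = b → 0 ≤ RCLike.re b := fun a b ha hab => by
      subst hab; simpa using ha
    refine h2 _ _ h ?_
    refine Finsupp.sum_congr fun x _ => Finsupp.sum_congr fun y _ => ?_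
    simp [kernelMatrix, abs_sub_comm (x _) (y _)]
    ring

/-- The reproducing kernel Hilbert space `H` of real functions on `ℝ^p` with kernel
`k(x, x') = h(‖x - x'‖_q ^ q)`. -/
abbrev KernelSpace (μ : Measure ℝ≥0) [IsFiniteMeasure μ] (q p : ℕ) [Fact (q = 1 ∨ q = 2)] :
    Type :=
  RKHS.OfKernel (kernelMatrix μ q p)

/-! ### The objective -/

/-- The rescaled feature vector `β^{1/q} ⊙ x`. -/
noncomputable def rescale (q : ℕ) {p : ℕ} (β x : Fin p → ℝ) : Fin p → ℝ :=
  fun i => β i ^ (1 / (q : ℝ)) * x i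

/-- The kernel ridge regression objective
`F_λ(β; Q) = min_{f ∈ H} (1/2) E_Q[(Y - f(β^{1/q} ⊙ X))²] + (λ/2) ‖f‖_H²`,
where `Q` is the joint law of `(X, Y)`. -/
noncomputable def krrObjective (μ : Measure ℝ≥0) [IsFiniteMeasure μ] (q : ℕ) {p : ℕ}
    [Fact (q = 1 ∨ q = 2)] (Q : Measure ((Fin p → ℝ) × ℝ)) (lam : ℝ) (β : Fin p → ℝ) : ℝ :=
  ⨅ f : KernelSpace μ q p,
    ((1 / 2) * ∫ z, (z.2 - f (rescale q β z.1)) ^ 2 ∂Q + lam / 2 * ‖f‖ ^ 2)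

/-- The feasible set `{β : β ≥ 0, ‖β‖_∞ ≤ M}`. -/
def feasibleSet (p : ℕ) (M : ℝ) : Set (Fin p → ℝ) :=
  {β | (∀ i, 0 ≤ β i) ∧ ∀ i, |β i| ≤ M}

/-! ### Assumptions and the signal set -/

/-- The measure `μ` charges `(0, ∞)`, and its support is bounded and bounded away from zero. -/
structure KernelAssumption (μ : Measure ℝ≥0) : Prop where
  pos : 0 < μ (Set.Ioi 0)
  support_bounded : ∃ m M : ℝ≥0, 0 < m ∧ μ.support ⊆ Set.Icc m M

/-- `E_Q[Y] = 0`, the support of `(X, Y)` is bounded, and each coordinate of `X` has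
non-vanishing variance. -/
structure DistributionAssumption {p : ℕ} (Q : Measure ((Fin p → ℝ) × ℝ)) : Prop where
  centered : ∫ z, z.2 ∂Q = 0
  bounded : ∃ MX MY : ℝ, ∀ᵐ z ∂Q, (∀ i, |z.1 i| ≤ MX) ∧ |z.2| ≤ MY
  variance_pos : ∀ l, 0 < variance (fun z : (Fin p → ℝ) × ℝ => z.1 l) Q

/-- The subvector `X_T`. -/
def subvector {p : ℕ} (T : Finset (Fin p)) (z : (Fin p → ℝ) × ℝ) : T → ℝ :=
  fun i => z.1 i

/-- `E_Q[Y | X] = E_Q[Y | X_T]` and `X_T ⟂ X_{Tᶜ}` under `Q`. -/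
def IsSufficient {p : ℕ} (Q : Measure ((Fin p → ℝ) × ℝ)) (T : Finset (Fin p)) : Prop :=
  (Q[Prod.snd | MeasurableSpace.comap (Prod.fst : (Fin p → ℝ) × ℝ → (Fin p → ℝ)) inferInstance]
    =ᵐ[Q] Q[Prod.snd | MeasurableSpace.comap (subvector T) inferInstance]) ∧
  IndepFun (subvector T) (subvector Tᶜ) Q

/-- The signal set: the minimal `S` such that `E_Q[Y | X] = E_Q[Y | X_S]` and
`X_S ⟂ X_{Sᶜ}` under `Q`. -/
def IsSignalSet {p : ℕ} (Q : Measure ((Fin p → ℝ) × ℝ)) (S : Finset (Fin p)) : Prop :=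
  Minimal (IsSufficient Q) S

/-! ### Stationarity and self-penalization -/

/-- The partial derivative `∂_{β_j} F(β)` of a function on `D` (at a boundary point of `D`, it is
taken along `D`). -/
noncomputable def partialDeriv {p : ℕ} (F : (Fin p → ℝ) → ℝ) (D : Set (Fin p → ℝ))
    (β : Fin p → ℝ) (j : Fin p) : ℝ :=
  fderivWithin ℝ F D β (Pi.single j 1)

/-- The Clarke subdifferential at `β` of a locally Lipschitz function on `D` (a convex set with
interior points): the convex hull of all limits of gradients at points of differentiability,
interior to `D`, that converge to `β`. -/
def clarkeSubdifferential {p : ℕ} (F : (Fin p → ℝ) → ℝ) (D : Set (Fin p → ℝ))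
    (β : Fin p → ℝ) : Set (Fin p → ℝ) :=
  convexHull ℝ {g | ∃ b : ℕ → Fin p → ℝ,
    (∀ k, b k ∈ interior D ∧ DifferentiableAt ℝ F (b k)) ∧
    Tendsto b atTop (𝓝 β) ∧ Tendsto (fun k => partialDeriv F D (b k)) atTop (𝓝 g)}

/-- The normal cone of the convex set `D` at `β`. -/
def normalCone {p : ℕ} (D : Set (Fin p → ℝ)) (β : Fin p → ℝ) : Set (Fin p → ℝ) :=
  {v | ∀ γ ∈ D, ∑ i, v i * (γ i - β i) ≤ 0}

/-- The set of Clarke stationary points of `min_{β ∈ D} F(β)`. -/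
def stationaryPoints {p : ℕ} (F : (Fin p → ℝ) → ℝ) (D : Set (Fin p → ℝ)) :
    Set (Fin p → ℝ) :=
  {β ∈ D | (0 : Fin p → ℝ) ∈ clarkeSubdifferential F D β + normalCone D β}

/-- The objective `F` on the feasible set `D` is self-penalizing with respect to `B`, for the
signal set `S`. -/
structure SelfPenalizing {p : ℕ} (S : Finset (Fin p)) (D : Set (Fin p → ℝ))
    (F : (Fin p → ℝ) → ℝ) (B : Set (Fin p → ℝ)) : Prop where
  locallyLipschitz : LocallyLipschitzOn D F
  relatively_open : ∃ U : Set (Fin p → ℝ), IsOpen U ∧ B = U ∩ D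
  gradient_bound : ∃ B₀ ⊆ B, B ⊆ closure B₀ ∧
    (∀ β ∈ B₀, DifferentiableWithinAt ℝ F D β) ∧
    ∃ κ > 0, ∀ j ∉ S, ∀ β ∈ B₀, κ ≤ Real.sign (β j) * partialDeriv F D β j
  exists_stationary : ∃ β ∈ B, β ∈ stationaryPoints F D ∧ Function.support β ⊆ S

/-- The set `B_{c,δ,λ} = {β ∈ D : F(0) - F(β) > c, ‖β_{Sᶜ}‖₁ < δ c² λ³}`. -/
def levelSet {p : ℕ} (S : Finset (Fin p)) (D : Set (Fin p → ℝ)) (F : (Fin p → ℝ) → ℝ)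
    (c δ lam : ℝ) : Set (Fin p → ℝ) :=
  {β ∈ D | F 0 - F β > c ∧ ∑ j ∈ Sᶜ, |β j| < δ * c ^ 2 * lam ^ 3}

end SelfPen

open SelfPen

/-! Everything is expressed through the residual `r = Y - f(β^{1/q} ⊙ X)` of the ridge minimizer
`f`. The normal equation, tested against features, becomes an equation in `L^∞(Q)`: `λ E[s r] + ⟨s,
r⟩ = λ E[s Y]`, where `⟨s, r⟩ = ∫∫ s r' h(∑ β_i |x_i - x'_i|^q)` is positive semidefinite and
depends on `β` linearly inside `h`. Comparing the equations at two weights gives the exact increment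
`IsResidual.krrObjective_sub`. Hence the objective is differentiable along the box, with `∂_j F =
(1/2λ) ∫∫ r r' (-h')(∑ β_i |x_i - x'_i|^q) |x_j - x'_j|^q`; it has Lipschitz constant of order
`1/λ`, its gradient one of order `1/λ²`.

Penalization of noise. If `β` is carried by `S`, then `r` is a function of `Y` and `X_S`, and
sufficiency of `S` factorizes the derivative for `j ∉ S` into the form with kernel `-h'` times
`E|X_j - X'_j|^q > 0` (`IsResidual.krrGradient_eq`). As `μ` lives on `[m, ∞)`, the function `-h' - m
h` is again a Laplace transform, so the form with `-h'` is at least `m ⟨r, r⟩`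
(`crossForm_moment_one_lower_bound`). A gain `c` over `β = 0` equals `⟨Y, r⟩ / 2λ` at least, and
Cauchy-Schwarz makes `⟨r, r⟩` at least of order `λ² c²` (`IsResidual.crossForm_self_lower_bound`).
So the derivative is at least of order `λ c²`. Moving off `S` by less than `δ c² λ³` changes the
gradient by at most order `δ λ c²`, which is harmless for small `δ`. Deleting the noise coordinates
does not increase `F`, so a minimizer over the weights carried by `S` stays in the level set; its
noise derivatives are nonnegative, so it is stationary in the whole box (`selfPenalizing_levelSet`).

Nonemptiness. If no function of the kernel space correlated with `Y` for any weights carried by `S`,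
then differentiating kernel averages in the weights would kill all mixed moments of `Y` with `(X_i +
R)^q`, `i ∈ S`, hence `E[Y | X_S] = 0`. Then `∅` would be sufficient, against minimality of `S ≠ ∅`
(`exists_integral_response_ne_zero`). A correlated function, suitably scaled, gives a gain uniform
in `λ ≤ 1` (`exists_gain`). -/

namespace SelfPen

/-! ### Laplace moments of `μ`: derivatives, Taylor bounds, positivity. -/

/-- The moments `h_n(z) = ∫ t^n e^{-tz} μ(dt)`. -/
noncomputable def laplaceMoment (μ : Measure ℝ≥0) (n : ℕ) (z : ℝ) : ℝ :=
  ∫ t : ℝ≥0, (t : ℝ) ^ n * Real.exp (-((t : ℝ) * z)) ∂μ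

theorem laplaceMoment_zero (μ : Measure ℝ≥0) : laplaceMoment μ 0 = laplaceFun μ := by
  ext z
  simp [laplaceMoment, laplaceFun]

theorem KernelAssumption.ae_mem {μ : Measure ℝ≥0} (hμ : KernelAssumption μ) :
    ∃ m T : ℝ, 0 < m ∧ ∀ᵐ t : ℝ≥0 ∂μ, m ≤ (t : ℝ) ∧ (t : ℝ) ≤ T := by
  obtain ⟨m, T, hm, hs⟩ := hμ.support_bounded
  refine ⟨m, T, by exact_mod_cast hm, ?_⟩
  filter_upwards [Measure.support_mem_ae (μ := μ)] with t ht
  exact ⟨by exact_mod_cast (hs ht).1, by exact_mod_cast (hs ht).2⟩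

theorem integrable_laplaceMoment {μ : Measure ℝ≥0} [IsFiniteMeasure μ] {T : ℝ}
    (hT : ∀ᵐ t : ℝ≥0 ∂μ, (t : ℝ) ≤ T) (n : ℕ) (z : ℝ) :
    Integrable (fun t : ℝ≥0 => (t : ℝ) ^ n * Real.exp (-((t : ℝ) * z))) μ := by
  refine Integrable.of_bound (C := T ^ n * Real.exp (T * |z|))
    (by fun_prop : Measurable _).aestronglyMeasurable ?_
  filter_upwards [hT] with t ht
  have h0 := t.2
  have ht0 : (0 : ℝ) ≤ T := h0.trans ht
  rw [Real.norm_eq_abs, abs_mul, Real.abs_exp, abs_of_nonneg (by positivity)]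
  gcongr
  calc -((t : ℝ) * z) ≤ |(t : ℝ) * z| := neg_le_abs _
    _ = t * |z| := by rw [abs_mul, NNReal.abs_eq]
    _ ≤ T * |z| := by gcongr

/-- Since `t` is bounded under `μ`, differentiation under the integral works at every real `z`,
including `z ≤ 0`; no one-sided derivative at `0` is needed. -/
theorem hasDerivAt_laplaceMoment {μ : Measure ℝ≥0} [IsFiniteMeasure μ] {T : ℝ}
    (hT : ∀ᵐ t : ℝ≥0 ∂μ, (t : ℝ) ≤ T) (n : ℕ) (z : ℝ) :
    HasDerivAt (laplaceMoment μ n) (-laplaceMoment μ (n + 1) z) z := by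
  have h := (hasDerivAt_integral_of_dominated_loc_of_deriv_le (μ := μ) (s := Metric.ball z 1)
    (F := fun (z : ℝ) (t : ℝ≥0) => (t : ℝ) ^ n * Real.exp (-((t : ℝ) * z)))
    (F' := fun (z : ℝ) (t : ℝ≥0) => -((t : ℝ) ^ (n + 1) * Real.exp (-((t : ℝ) * z)))) (x₀ := z)
    (bound := fun _ => T ^ (n + 1) * Real.exp (T * (|z| + 1))) (Metric.ball_mem_nhds z one_pos)
    (.of_forall fun x => (by fun_prop : Measurable _).aestronglyMeasurable)
    (integrable_laplaceMoment hT n z) (by fun_prop : Measurable _).aestronglyMeasurable ?_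
    (integrable_const _) ?_).2
  · rw [integral_neg] at h
    exact h
  · filter_upwards [hT] with t ht x hx
    have h0 := t.2
    have ht0 : (0 : ℝ) ≤ T := h0.trans ht
    have hx' : |x| ≤ |z| + 1 := by
      have := abs_sub_abs_le_abs_sub x z
      rw [Metric.mem_ball, Real.dist_eq] at hx
      linarith
    rw [norm_neg, Real.norm_eq_abs, abs_mul, Real.abs_exp, abs_of_nonneg (by positivity)]
    gcongr
    calc -((t : ℝ) * x) ≤ |(t : ℝ) * x| := neg_le_abs _
      _ = t * |x| := by rw [abs_mul, NNReal.abs_eq]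
      _ ≤ T * (|z| + 1) := by gcongr
  · refine .of_forall fun t x _ => ?_
    have h1 : HasDerivAt (fun x : ℝ => -((t : ℝ) * x)) (-(t : ℝ)) x := by
      simpa using ((hasDerivAt_id' x).const_mul (t : ℝ)).fun_neg
    exact (h1.exp.const_mul ((t : ℝ) ^ n)).congr_deriv (by ring)

theorem continuous_laplaceMoment {μ : Measure ℝ≥0} [IsFiniteMeasure μ] {T : ℝ}
    (hT : ∀ᵐ t : ℝ≥0 ∂μ, (t : ℝ) ≤ T) (n : ℕ) : Continuous (laplaceMoment μ n) :=
  continuous_iff_continuousAt.2 fun z => (hasDerivAt_laplaceMoment hT n z).continuousAt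

theorem laplaceMoment_nonneg (μ : Measure ℝ≥0) (n : ℕ) (z : ℝ) : 0 ≤ laplaceMoment μ n z :=
  integral_nonneg fun t => by positivity

theorem laplaceMoment_le {μ : Measure ℝ≥0} [IsFiniteMeasure μ] {T : ℝ}
    (hT : ∀ᵐ t : ℝ≥0 ∂μ, (t : ℝ) ≤ T) (n : ℕ) {z : ℝ} (hz : 0 ≤ z) :
    laplaceMoment μ n z ≤ laplaceMoment μ n 0 := by
  refine integral_mono (integrable_laplaceMoment hT n z) (integrable_laplaceMoment hT n 0) ?_
  intro t
  dsimp only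
  gcongr

theorem abs_laplaceMoment_sub_le {μ : Measure ℝ≥0} [IsFiniteMeasure μ] {T : ℝ}
    (hT : ∀ᵐ t : ℝ≥0 ∂μ, (t : ℝ) ≤ T) (n : ℕ) {a b : ℝ} (ha : 0 ≤ a) (hb : 0 ≤ b) :
    |laplaceMoment μ n b - laplaceMoment μ n a| ≤ laplaceMoment μ (n + 1) 0 * |b - a| := by
  refine (convex_Ici (0 : ℝ)).norm_image_sub_le_of_norm_hasDerivWithin_le
    (fun x _ => (hasDerivAt_laplaceMoment hT n x).hasDerivWithinAt) (fun x hx => ?_) ha hb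
  rw [norm_neg, Real.norm_eq_abs, abs_of_nonneg (laplaceMoment_nonneg _ _ _)]
  exact laplaceMoment_le hT _ hx

/-- Mean value inequality for `x ↦ h_n(x) + h_{n+1}(a) x`, whose derivative vanishes at `a` and is
Lipschitz. This loses the factor `1/2` of Taylor's formula, which is immaterial here. -/
theorem abs_laplaceMoment_sub_add_le {μ : Measure ℝ≥0} [IsFiniteMeasure μ] {T : ℝ}
    (hT : ∀ᵐ t : ℝ≥0 ∂μ, (t : ℝ) ≤ T) (n : ℕ) {a b : ℝ} (ha : 0 ≤ a) (hb : 0 ≤ b) :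
    |laplaceMoment μ n b - laplaceMoment μ n a + laplaceMoment μ (n + 1) a * (b - a)| ≤
      laplaceMoment μ (n + 2) 0 * (b - a) ^ 2 := by
  have key := (convex_uIcc a b).norm_image_sub_le_of_norm_hasDerivWithin_le
    (f := fun x => laplaceMoment μ n x + laplaceMoment μ (n + 1) a * x)
    (f' := fun x => -laplaceMoment μ (n + 1) x + laplaceMoment μ (n + 1) a)
    (C := laplaceMoment μ (n + 2) 0 * |b - a|) (x := a) (y := b)
    (fun x _ => by
      simpa using ((hasDerivAt_laplaceMoment hT n x).fun_add
        ((hasDerivAt_id' x).const_mul (laplaceMoment μ (n + 1) a))).hasDerivWithinAt)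
    (fun x hx => by
      have hx0 : 0 ≤ x := (le_min ha hb).trans hx.1
      rw [neg_add_eq_sub, Real.norm_eq_abs]
      refine (abs_laplaceMoment_sub_le hT (n + 1) hx0 ha).trans ?_
      have := Set.abs_sub_left_of_mem_uIcc hx
      rw [abs_sub_comm]
      exact mul_le_mul_of_nonneg_left this (laplaceMoment_nonneg _ _ _))
    Set.left_mem_uIcc Set.right_mem_uIcc
  rw [Real.norm_eq_abs, Real.norm_eq_abs, mul_assoc, ← sq, sq_abs] at key
  convert key using 2
  ring

/-- The charge of `(0, ∞)` enters here: without it `h` would be constant and the kernel blind to all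
features. -/
theorem laplaceMoment_pos {μ : Measure ℝ≥0} [IsFiniteMeasure μ] (hμ : KernelAssumption μ)
    (n : ℕ) (z : ℝ) : 0 < laplaceMoment μ n z := by
  obtain ⟨m, T, hm, h⟩ := hμ.ae_mem
  refine (integral_pos_iff_support_of_nonneg (fun t => by positivity)
    (integrable_laplaceMoment (h.mono fun t ht => ht.2) n z)).2 (hμ.pos.trans_le (measure_mono ?_))
  intro t ht
  have : (0 : ℝ) < t := by exact_mod_cast ht
  simp only [Function.mem_support]
  positivity

end SelfPen

/-! ### Bilinear forms on the product space. -/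

namespace SelfPen
open scoped InnerProductSpace

/-- The form `∫∫ r(z) s(z') κ(z, z') Q(dz) Q(dz')`. -/
noncomputable def crossForm {Ω : Type*} [MeasurableSpace Ω] (Q : Measure Ω) (κ : Ω × Ω → ℝ)
    (r s : Ω → ℝ) : ℝ :=
  ∫ w, r w.1 * s w.2 * κ w ∂(Q.prod Q)

section CrossForm
variable {Ω : Type*} [MeasurableSpace Ω] {Q : Measure Ω} [IsProbabilityMeasure Q]

theorem _root_.MeasureTheory.MemLp.mul_top {α : Type*} [MeasurableSpace α] {P : Measure α} {f g : α → ℝ}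
    (hf : MemLp f ⊤ P) (hg : MemLp g ⊤ P) : MemLp (fun x => f x * g x) ⊤ P :=
  MemLp.mul (p := ⊤) (q := ⊤) (r := ⊤) hg hf

theorem _root_.MeasureTheory.MemLp.integrable_top {α : Type*} [MeasurableSpace α] {P : Measure α} [IsFiniteMeasure P]
    {f : α → ℝ} (hf : MemLp f ⊤ P) : Integrable f P :=
  hf.integrable le_top

theorem _root_.MeasureTheory.MemLp.abs_top {α : Type*} [MeasurableSpace α] {P : Measure α}
    {f : α → ℝ} (hf : MemLp f ⊤ P) : MemLp (fun x => |f x|) ⊤ P :=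
  hf.abs

theorem memLp_top_fst {f : Ω → ℝ} (hf : MemLp f ⊤ Q) :
    MemLp (fun w : Ω × Ω => f w.1) ⊤ (Q.prod Q) :=
  hf.comp_measurePreserving measurePreserving_fst

theorem memLp_top_snd {f : Ω → ℝ} (hf : MemLp f ⊤ Q) :
    MemLp (fun w : Ω × Ω => f w.2) ⊤ (Q.prod Q) :=
  hf.comp_measurePreserving measurePreserving_snd

theorem integrable_crossForm {κ : Ω × Ω → ℝ} {r s : Ω → ℝ} (hκ : MemLp κ ⊤ (Q.prod Q))
    (hr : MemLp r ⊤ Q) (hs : MemLp s ⊤ Q) :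
    Integrable (fun w : Ω × Ω => r w.1 * s w.2 * κ w) (Q.prod Q) :=
  (((memLp_top_fst hr).mul_top (memLp_top_snd hs)).mul_top hκ).integrable_top

theorem crossForm_eq_integral_integral {κ : Ω × Ω → ℝ} {r s : Ω → ℝ}
    (hκ : MemLp κ ⊤ (Q.prod Q)) (hr : MemLp r ⊤ Q) (hs : MemLp s ⊤ Q) :
    crossForm Q κ r s = ∫ z, r z * ∫ z', s z' * κ (z, z') ∂Q ∂Q := by
  rw [crossForm, integral_prod _ (integrable_crossForm hκ hr hs)]
  refine integral_congr_ae (.of_forall fun z => ?_)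
  simp only [mul_assoc, integral_const_mul]

theorem crossForm_comm {κ : Ω × Ω → ℝ} (hsymm : ∀ w, κ w.swap = κ w) (r s : Ω → ℝ) :
    crossForm Q κ r s = crossForm Q κ s r := by
  rw [crossForm, ← integral_prod_swap]
  refine integral_congr_ae (.of_forall fun w => ?_)
  simp only [hsymm, Prod.fst_swap, Prod.snd_swap]
  ring

theorem abs_crossForm_le {κ : Ω × Ω → ℝ} {r s : Ω → ℝ} {C : ℝ}
    (hκ : ∀ᵐ w ∂(Q.prod Q), |κ w| ≤ C) (hr : MemLp r ⊤ Q) (hs : MemLp s ⊤ Q) :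
    |crossForm Q κ r s| ≤ C * ((∫ z, |r z| ∂Q) * ∫ z, |s z| ∂Q) := by
  have h2 := ((memLp_top_fst hr).abs_top.mul_top (memLp_top_snd hs).abs_top).integrable_top
  refine (norm_integral_le_of_norm_le (f := fun w : Ω × Ω => r w.1 * s w.2 * κ w)
    (h2.const_mul C) ?_).trans_eq ?_
  · filter_upwards [hκ] with w hw
    rw [Real.norm_eq_abs, abs_mul, abs_mul, mul_comm]
    exact mul_le_mul_of_nonneg_right hw (by positivity)
  · rw [integral_const_mul]
    congr 1
    exact integral_prod_mul (L := ℝ) (fun z => |r z|) (fun z => |s z|)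

theorem crossForm_sub_left {κ : Ω × Ω → ℝ} {r r' s : Ω → ℝ} (hκ : MemLp κ ⊤ (Q.prod Q))
    (hr : MemLp r ⊤ Q) (hr' : MemLp r' ⊤ Q) (hs : MemLp s ⊤ Q) :
    crossForm Q κ (fun z => r z - r' z) s = crossForm Q κ r s - crossForm Q κ r' s := by
  rw [crossForm, crossForm, crossForm,
    ← integral_sub (integrable_crossForm hκ hr hs) (integrable_crossForm hκ hr' hs)]
  exact integral_congr_ae (.of_forall fun w => by ring)

theorem crossForm_sub_right {κ : Ω × Ω → ℝ} {r s s' : Ω → ℝ} (hκ : MemLp κ ⊤ (Q.prod Q))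
    (hr : MemLp r ⊤ Q) (hs : MemLp s ⊤ Q) (hs' : MemLp s' ⊤ Q) :
    crossForm Q κ r (fun z => s z - s' z) = crossForm Q κ r s - crossForm Q κ r s' := by
  rw [crossForm, crossForm, crossForm,
    ← integral_sub (integrable_crossForm hκ hr hs) (integrable_crossForm hκ hr hs')]
  exact integral_congr_ae (.of_forall fun w => by ring)

omit [IsProbabilityMeasure Q] in
theorem crossForm_const_mul_left {κ : Ω × Ω → ℝ} (c : ℝ) (r s : Ω → ℝ) :
    crossForm Q κ (fun z => c * r z) s = c * crossForm Q κ r s := by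
  rw [crossForm, crossForm, ← integral_const_mul]
  exact integral_congr_ae (.of_forall fun w => by ring)

omit [IsProbabilityMeasure Q] in
theorem crossForm_const_mul_right {κ : Ω × Ω → ℝ} (c : ℝ) (r s : Ω → ℝ) :
    crossForm Q κ r (fun z => c * s z) = c * crossForm Q κ r s := by
  rw [crossForm, crossForm, ← integral_const_mul]
  exact integral_congr_ae (.of_forall fun w => by ring)

theorem crossForm_kernel_sub {κ κ' : Ω × Ω → ℝ} {r s : Ω → ℝ} (hκ : MemLp κ ⊤ (Q.prod Q))
    (hκ' : MemLp κ' ⊤ (Q.prod Q)) (hr : MemLp r ⊤ Q) (hs : MemLp s ⊤ Q) :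
    crossForm Q (fun w => κ w - κ' w) r s = crossForm Q κ r s - crossForm Q κ' r s := by
  rw [crossForm, crossForm, crossForm,
    ← integral_sub (integrable_crossForm hκ hr hs) (integrable_crossForm hκ' hr hs)]
  exact integral_congr_ae (.of_forall fun w => by ring)

/-- Nonnegativity of the variance of `|f|`. Forms with bounded kernels are controlled by `L¹` norms,
while the normal equation produces `E[f²]`; this passes from one to the other. -/
theorem sq_integral_abs_le {f : Ω → ℝ} (hf : MemLp f ⊤ Q) :
    (∫ z, |f z| ∂Q) ^ 2 ≤ ∫ z, f z * f z ∂Q := by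
  have h := variance_nonneg (fun z => |f z|) Q
  rw [variance_eq_sub (hf.abs_top.mono_exponent le_top)] at h
  simp only [Pi.pow_apply, sq_abs] at h
  simp only [← sq]
  linarith

end CrossForm

/-! ### Ridge regression with a bounded feature map in a Hilbert space. -/

section Ridge
variable {Ω : Type*} [MeasurableSpace Ω] {Q : Measure Ω} [IsProbabilityMeasure Q]
  {H : Type*} [NormedAddCommGroup H] [InnerProductSpace ℝ H] [CompleteSpace H]

omit [IsProbabilityMeasure Q] [CompleteSpace H] in
theorem memLp_top_inner_feature {Φ : Ω → H} {C : ℝ} (hC : ∀ z, ‖Φ z‖ ≤ C)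
    (hmeas : ∀ f, Measurable fun z => ⟪Φ z, f⟫_ℝ) (f : H) :
    MemLp (fun z => ⟪Φ z, f⟫_ℝ) ⊤ Q :=
  memLp_top_of_bound (hmeas f).aestronglyMeasurable (C * ‖f‖) (.of_forall fun z =>
    (norm_inner_le_norm _ _).trans (mul_le_mul_of_nonneg_right (hC z) (norm_nonneg _)))

/-- The weak integral `∫ s(z) Φ(z) Q(dz)` of a bounded feature map. -/
theorem exists_weakIntegral {Φ : Ω → H} {C : ℝ} (hC : ∀ z, ‖Φ z‖ ≤ C)
    (hmeas : ∀ f, Measurable fun z => ⟪Φ z, f⟫_ℝ) {s : Ω → ℝ} (hs : MemLp s ⊤ Q) :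
    ∃ v : H, ∀ g, ⟪v, g⟫_ℝ = ∫ z, s z * ⟪Φ z, g⟫_ℝ ∂Q := by
  have hint : ∀ g, Integrable (fun z => s z * ⟪Φ z, g⟫_ℝ) Q := fun g =>
    (hs.mul_top (memLp_top_inner_feature hC hmeas g)).integrable_top
  let ℓ : H →ₗ[ℝ] ℝ :=
    { toFun := fun g => ∫ z, s z * ⟪Φ z, g⟫_ℝ ∂Q
      map_add' := fun g g' => by
        rw [← integral_add (hint g) (hint g')]
        simp only [inner_add_right, mul_add]
      map_smul' := fun c g => by
        rw [RingHom.id_apply, smul_eq_mul, ← integral_const_mul]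
        simp only [inner_smul_right]
        exact integral_congr_ae (.of_forall fun z => by ring) }
  -- Riesz representation of this functional replaces the Bochner integral, so only weak
  -- measurability of `Φ` is required.
  let L : H →L[ℝ] ℝ := ℓ.mkContinuous (C * ∫ z, |s z| ∂Q) fun g => by
    refine (norm_integral_le_of_norm_le (hs.abs_top.integrable_top.const_mul (C * ‖g‖))
      (.of_forall fun z => ?_)).trans_eq ?_
    · rw [norm_mul, mul_comm]
      exact mul_le_mul_of_nonneg_right ((norm_inner_le_norm _ _).trans
        (mul_le_mul_of_nonneg_right (hC z) (norm_nonneg _))) (abs_nonneg _)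
    · rw [integral_const_mul]
      ring
  exact ⟨(InnerProductSpace.toDual ℝ H).symm L, fun g => InnerProductSpace.toDual_symm_apply⟩

omit [IsProbabilityMeasure Q] [CompleteSpace H] in
theorem memLp_top_featureKernel {Φ : Ω → H} {C : ℝ} (hC : ∀ z, ‖Φ z‖ ≤ C)
    (hker : Measurable fun w : Ω × Ω => ⟪Φ w.1, Φ w.2⟫_ℝ) :
    MemLp (fun w : Ω × Ω => ⟪Φ w.1, Φ w.2⟫_ℝ) ⊤ (Q.prod Q) := by
  refine memLp_top_of_bound hker.aestronglyMeasurable (C * C) (.of_forall fun w => ?_)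
  exact (norm_inner_le_norm _ _).trans
    (mul_le_mul (hC _) (hC _) (norm_nonneg _) ((norm_nonneg _).trans (hC w.1)))

/-- The form is the squared norm of the weak integral `∫ s Φ dQ`. -/
theorem crossForm_featureKernel_nonneg {Φ : Ω → H} {C : ℝ} (hC : ∀ z, ‖Φ z‖ ≤ C)
    (hmeas : ∀ f, Measurable fun z => ⟪Φ z, f⟫_ℝ)
    (hker : Measurable fun w : Ω × Ω => ⟪Φ w.1, Φ w.2⟫_ℝ) {s : Ω → ℝ} (hs : MemLp s ⊤ Q) :
    0 ≤ crossForm Q (fun w => ⟪Φ w.1, Φ w.2⟫_ℝ) s s := by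
  obtain ⟨v, hv⟩ := exists_weakIntegral hC hmeas hs
  rw [crossForm_eq_integral_integral (memLp_top_featureKernel hC hker) hs hs]
  have : ∀ z, ∫ z', s z' * ⟪Φ z, Φ z'⟫_ℝ ∂Q = ⟪Φ z, v⟫_ℝ := fun z => by
    rw [real_inner_comm, hv]
    simp only [real_inner_comm]
  simp only [this]
  rw [← hv v]
  exact real_inner_self_nonneg

/-- The normal equation of ridge regression with a bounded feature map. -/
theorem exists_ridge_minimizer {Φ : Ω → H} {C : ℝ} (hC : ∀ z, ‖Φ z‖ ≤ C)
    (hmeas : ∀ f, Measurable fun z => ⟪Φ z, f⟫_ℝ) {Y : Ω → ℝ} (hY : MemLp Y ⊤ Q) {lam : ℝ}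
    (hlam : 0 < lam) :
    ∃ f : H, ∀ g, lam * ⟪f, g⟫_ℝ = ∫ z, (Y z - ⟪Φ z, f⟫_ℝ) * ⟪Φ z, g⟫_ℝ ∂Q := by
  have hmem := memLp_top_inner_feature (Q := Q) hC hmeas
  have hint : ∀ f g, Integrable (fun z => ⟪Φ z, f⟫_ℝ * ⟪Φ z, g⟫_ℝ) Q := fun f g =>
    ((hmem f).mul_top (hmem g)).integrable_top
  let b : H →ₗ[ℝ] H →ₗ[ℝ] ℝ := LinearMap.mk₂ ℝ
    (fun f g => ∫ z, ⟪Φ z, f⟫_ℝ * ⟪Φ z, g⟫_ℝ ∂Q + lam * ⟪f, g⟫_ℝ)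
    (fun f f' g => by
      simp only [inner_add_right, inner_add_left, add_mul]
      rw [integral_add (hint f g) (hint f' g)]
      ring)
    (fun c f g => by
      simp only [inner_smul_right, real_inner_smul_left, smul_eq_mul, mul_assoc]
      rw [integral_const_mul]
      ring)
    (fun f g g' => by
      simp only [inner_add_right, mul_add]
      rw [integral_add (hint f g) (hint f g')]
      ring)
    (fun c f g => by
      simp only [inner_smul_right, smul_eq_mul, mul_left_comm _ c]
      rw [integral_const_mul]
      ring)
  let B' : H →L[ℝ] H →L[ℝ] ℝ := b.mkContinuous₂ (C * C + lam) (fun f g => by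
    rw [add_mul, add_mul]
    refine (norm_add_le _ _).trans (add_le_add ?_ ?_)
    · refine (norm_integral_le_of_norm_le_const (C := C * ‖f‖ * (C * ‖g‖))
        (.of_forall fun z => ?_)).trans_eq ?_
      · rw [norm_mul]
        have h1 : ∀ f, ‖⟪Φ z, f⟫_ℝ‖ ≤ C * ‖f‖ := fun f => (norm_inner_le_norm _ _).trans
          (mul_le_mul_of_nonneg_right (hC z) (norm_nonneg _))
        exact mul_le_mul (h1 f) (h1 g) (norm_nonneg _) ((norm_nonneg _).trans (h1 f))
      · rw [probReal_univ]
        ring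
    · rw [norm_mul, Real.norm_of_nonneg hlam.le, mul_assoc]
      exact mul_le_mul_of_nonneg_left (norm_inner_le_norm _ _) hlam.le)
  have hB' : ∀ f g, B' f g = ∫ z, ⟪Φ z, f⟫_ℝ * ⟪Φ z, g⟫_ℝ ∂Q + lam * ⟪f, g⟫_ℝ := fun f g => rfl
  -- Lax-Milgram: the ridge term alone gives coercivity with constant `lam`.
  have hco : IsCoercive B' := by
    refine ⟨lam, hlam, fun f => ?_⟩
    rw [hB', real_inner_self_eq_norm_sq, mul_assoc, sq]
    exact le_add_of_nonneg_left (integral_nonneg fun z => mul_self_nonneg _)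
  obtain ⟨v, hv⟩ := exists_weakIntegral hC hmeas hY
  refine ⟨hco.continuousLinearEquivOfBilin.symm v, fun g => ?_⟩
  set f := hco.continuousLinearEquivOfBilin.symm v with hf
  have h := hco.continuousLinearEquivOfBilin_apply f g
  rw [hf, ContinuousLinearEquiv.apply_symm_apply, ← hf, hv, hB'] at h
  simp only [sub_mul]
  rw [integral_sub ((hY.mul_top (hmem g)).integrable_top) (hint f g)]
  linarith

omit [CompleteSpace H] in
/-- The optimal value of ridge regression. -/
theorem ridge_value {Φ : Ω → H} {C : ℝ} (hC : ∀ z, ‖Φ z‖ ≤ C)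
    (hmeas : ∀ f, Measurable fun z => ⟪Φ z, f⟫_ℝ) {Y : Ω → ℝ} (hY : MemLp Y ⊤ Q) {lam : ℝ}
    (hlam : 0 < lam) {f : H}
    (hf : ∀ g, lam * ⟪f, g⟫_ℝ = ∫ z, (Y z - ⟪Φ z, f⟫_ℝ) * ⟪Φ z, g⟫_ℝ ∂Q) :
    ⨅ g : H, ((1 / 2) * ∫ z, (Y z - ⟪Φ z, g⟫_ℝ) ^ 2 ∂Q + lam / 2 * ‖g‖ ^ 2) =
      (1 / 2) * ∫ z, Y z * (Y z - ⟪Φ z, f⟫_ℝ) ∂Q := by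
  have hmem := memLp_top_inner_feature (Q := Q) hC hmeas
  -- Completing the square around `f`: the cross terms `E[r f] - 2 E[r g]` are inner products by the
  -- normal equation, and the excess is a sum of squares in `g - f`.
  have hval : ∀ g, (1 / 2) * ∫ z, (Y z - ⟪Φ z, g⟫_ℝ) ^ 2 ∂Q + lam / 2 * ‖g‖ ^ 2 =
      (1 / 2) * ∫ z, Y z * (Y z - ⟪Φ z, f⟫_ℝ) ∂Q +
        ((1 / 2) * ∫ z, ⟪Φ z, g - f⟫_ℝ * ⟪Φ z, g - f⟫_ℝ ∂Q + lam / 2 * ‖g - f‖ ^ 2) := by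
    intro g
    have hr : MemLp (fun z => Y z - ⟪Φ z, f⟫_ℝ) ⊤ Q := hY.sub (hmem f)
    have i1 := (hY.mul_top hr).integrable_top
    have i2 := (hr.mul_top (hmem g)).integrable_top
    have i3 := ((hmem (g - f)).mul_top (hmem (g - f))).integrable_top
    have i4 := (hr.mul_top (hmem f)).integrable_top
    have i5 : Integrable (fun z => Y z * (Y z - ⟪Φ z, f⟫_ℝ) +
      ⟪Φ z, g - f⟫_ℝ * ⟪Φ z, g - f⟫_ℝ) Q := i1.add i3
    have i6 : Integrable (fun z => Y z * (Y z - ⟪Φ z, f⟫_ℝ) +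
      ⟪Φ z, g - f⟫_ℝ * ⟪Φ z, g - f⟫_ℝ + (Y z - ⟪Φ z, f⟫_ℝ) * ⟪Φ z, f⟫_ℝ) Q := i5.add i4
    have e : ∫ z, (Y z - ⟪Φ z, g⟫_ℝ) ^ 2 ∂Q = ∫ z, Y z * (Y z - ⟪Φ z, f⟫_ℝ) ∂Q
        + ∫ z, ⟪Φ z, g - f⟫_ℝ * ⟪Φ z, g - f⟫_ℝ ∂Q
        + ∫ z, (Y z - ⟪Φ z, f⟫_ℝ) * ⟪Φ z, f⟫_ℝ ∂Q
        - 2 * ∫ z, (Y z - ⟪Φ z, f⟫_ℝ) * ⟪Φ z, g⟫_ℝ ∂Q := by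
      rw [← integral_const_mul, ← integral_add i1 i3, ← integral_add i5 i4,
        ← integral_sub i6 (i2.const_mul 2)]
      refine integral_congr_ae (.of_forall fun z => ?_)
      simp only [inner_sub_right]
      ring
    rw [e, ← hf, ← hf, ← real_inner_self_eq_norm_sq, ← real_inner_self_eq_norm_sq,
      inner_sub_left, inner_sub_right, inner_sub_right, real_inner_comm f g]
    ring
  refine (IsLeast.csInf_eq ⟨⟨f, ?_⟩, ?_⟩)
  · dsimp only
    rw [hval f]
    simp
  · rintro _ ⟨g, rfl⟩
    dsimp only
    rw [hval g]
    refine le_add_of_nonneg_right (add_nonneg (mul_nonneg (by norm_num)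
      (integral_nonneg fun z => mul_self_nonneg _)) (by positivity))

end Ridge

end SelfPen

/-! ### The pair kernel, the kernel space and the residual equation. -/

namespace SelfPen
open scoped InnerProductSpace

/-- The gap `|x_j - x'_j|^q` of two observations in coordinate `j`. -/
def coordGap {p : ℕ} (q : ℕ) (j : Fin p)
    (w : ((Fin p → ℝ) × ℝ) × ((Fin p → ℝ) × ℝ)) : ℝ :=
  |w.1.1 j - w.2.1 j| ^ q

/-- The weighted distance `∑ β_i |x_i - x'_i|^q`. -/
def weightedGap {p : ℕ} (q : ℕ) (β : Fin p → ℝ)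
    (w : ((Fin p → ℝ) × ℝ) × ((Fin p → ℝ) × ℝ)) : ℝ :=
  ∑ i, β i * coordGap q i w

/-- The kernel `h_n(∑ β_i |x_i - x'_i|^q)`. -/
noncomputable def pairKernel {p : ℕ} (μ : Measure ℝ≥0) (n q : ℕ) (β : Fin p → ℝ)
    (w : ((Fin p → ℝ) × ℝ) × ((Fin p → ℝ) × ℝ)) : ℝ :=
  laplaceMoment μ n (weightedGap q β w)

section
variable {p : ℕ}

theorem coordGap_nonneg (q : ℕ) (j : Fin p) (w : ((Fin p → ℝ) × ℝ) × ((Fin p → ℝ) × ℝ)) :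
    0 ≤ coordGap q j w := by
  unfold coordGap
  positivity

theorem weightedGap_nonneg (q : ℕ) {β : Fin p → ℝ} (hβ : ∀ i, 0 ≤ β i)
    (w : ((Fin p → ℝ) × ℝ) × ((Fin p → ℝ) × ℝ)) : 0 ≤ weightedGap q β w :=
  Finset.sum_nonneg fun i _ => mul_nonneg (hβ i) (coordGap_nonneg q i w)

theorem measurable_coordGap (q : ℕ) (j : Fin p) : Measurable (coordGap q j) := by
  unfold coordGap
  fun_prop

theorem measurable_weightedGap (q : ℕ) (β : Fin p → ℝ) : Measurable (weightedGap q β) :=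
  Finset.measurable_fun_sum _ fun i _ => (measurable_coordGap q i).const_mul _

theorem coordGap_swap (q : ℕ) (j : Fin p) (w : ((Fin p → ℝ) × ℝ) × ((Fin p → ℝ) × ℝ)) :
    coordGap q j w.swap = coordGap q j w := by
  simp [coordGap, abs_sub_comm]

theorem pairKernel_swap (μ : Measure ℝ≥0) (n q : ℕ) (β : Fin p → ℝ)
    (w : ((Fin p → ℝ) × ℝ) × ((Fin p → ℝ) × ℝ)) :
    pairKernel μ n q β w.swap = pairKernel μ n q β w := by
  simp [pairKernel, weightedGap, coordGap_swap]

theorem measurable_pairKernel {μ : Measure ℝ≥0} [IsFiniteMeasure μ] {T : ℝ}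
    (hT : ∀ᵐ t : ℝ≥0 ∂μ, (t : ℝ) ≤ T) (n q : ℕ) (β : Fin p → ℝ) :
    Measurable (pairKernel μ n q β) :=
  (continuous_laplaceMoment hT n).measurable.comp (measurable_weightedGap q β)

theorem pairKernel_nonneg (μ : Measure ℝ≥0) (n q : ℕ) (β : Fin p → ℝ)
    (w : ((Fin p → ℝ) × ℝ) × ((Fin p → ℝ) × ℝ)) : 0 ≤ pairKernel μ n q β w :=
  laplaceMoment_nonneg _ _ _

theorem pairKernel_le {μ : Measure ℝ≥0} [IsFiniteMeasure μ] {T : ℝ}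
    (hT : ∀ᵐ t : ℝ≥0 ∂μ, (t : ℝ) ≤ T) (n q : ℕ) {β : Fin p → ℝ} (hβ : ∀ i, 0 ≤ β i)
    (w : ((Fin p → ℝ) × ℝ) × ((Fin p → ℝ) × ℝ)) :
    pairKernel μ n q β w ≤ laplaceMoment μ n 0 :=
  laplaceMoment_le hT n (weightedGap_nonneg q hβ w)

theorem memLp_top_pairKernel {μ : Measure ℝ≥0} [IsFiniteMeasure μ] {T : ℝ}
    (hT : ∀ᵐ t : ℝ≥0 ∂μ, (t : ℝ) ≤ T) (n q : ℕ) {β : Fin p → ℝ} (hβ : ∀ i, 0 ≤ β i)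
    (P : Measure (((Fin p → ℝ) × ℝ) × ((Fin p → ℝ) × ℝ))) :
    MemLp (pairKernel μ n q β) ⊤ P :=
  memLp_top_of_bound (measurable_pairKernel hT n q β).aestronglyMeasurable
    (laplaceMoment μ n 0) (.of_forall fun w => by
      rw [Real.norm_of_nonneg (pairKernel_nonneg _ _ _ _ _)]
      exact pairKernel_le hT n q hβ w)

/-- This is the purpose of the exponent `1/q`: the weights enter the argument of `h` linearly, and a
derivative in `β_i` only produces the factor `|x_i - y_i|^q`. -/
theorem abs_rescale_sub_pow {q : ℕ} (hq : q = 1 ∨ q = 2) {β : Fin p → ℝ} (hβ : ∀ i, 0 ≤ β i)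
    (x y : Fin p → ℝ) (i : Fin p) :
    |rescale q β x i - rescale q β y i| ^ q = β i * |x i - y i| ^ q := by
  have hq0 : q ≠ 0 := by rcases hq with rfl | rfl <;> norm_num
  rw [rescale, rescale, ← mul_sub, abs_mul, mul_pow,
    abs_of_nonneg (Real.rpow_nonneg (hβ i) _), one_div, Real.rpow_inv_natCast_pow (hβ i) hq0]

end

section KernelSpace
variable {p : ℕ} {μ : Measure ℝ≥0} [IsFiniteMeasure μ] {q : ℕ} [hq : Fact (q = 1 ∨ q = 2)]

/-- The canonical feature `k(x, ·)`. -/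
noncomputable def kernelFeature (μ : Measure ℝ≥0) [IsFiniteMeasure μ] (q : ℕ)
    [Fact (q = 1 ∨ q = 2)] (x : Fin p → ℝ) : KernelSpace μ q p :=
  RKHS.kerFun (KernelSpace μ q p) x 1

theorem inner_kernelFeature (x : Fin p → ℝ) (f : KernelSpace μ q p) :
    ⟪kernelFeature μ q x, f⟫_ℝ = f x := by
  rw [kernelFeature, RKHS.kerFun_inner]
  simp

theorem kernelFeature_apply (x y : Fin p → ℝ) :
    kernelFeature μ q x y = laplaceFun μ (∑ i, |x i - y i| ^ q) := by
  rw [kernelFeature, RKHS.kerFun_apply, RKHS.OfKernel.kernel_ofKernel]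
  simp [kernelMatrix, abs_sub_comm]

theorem norm_kernelFeature_sq (x : Fin p → ℝ) :
    ‖kernelFeature μ q x‖ ^ 2 = laplaceFun μ 0 := by
  have hq0 : q ≠ 0 := by rcases hq.out with rfl | rfl <;> norm_num
  rw [← real_inner_self_eq_norm_sq, inner_kernelFeature, kernelFeature_apply]
  simp [hq0]

theorem norm_kernelFeature (x : Fin p → ℝ) :
    ‖kernelFeature μ q x‖ = √(laplaceFun μ 0) := by
  rw [← norm_kernelFeature_sq (q := q) x, Real.sqrt_sq (norm_nonneg _)]

/-- By the reproducing property, `‖k(y, ·) - k(x, ·)‖² = 2 h(0) - 2 h(‖x - y‖_q^q)`. -/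
theorem continuous_kernelFeature {T : ℝ} (hT : ∀ᵐ t : ℝ≥0 ∂μ, (t : ℝ) ≤ T) :
    Continuous (kernelFeature μ q : (Fin p → ℝ) → KernelSpace μ q p) := by
  have hq0 : q ≠ 0 := by rcases hq.out with rfl | rfl <;> norm_num
  rw [continuous_iff_continuousAt]
  intro x
  rw [ContinuousAt, tendsto_iff_norm_sub_tendsto_zero]
  have h : ∀ y, ‖kernelFeature μ q y - kernelFeature μ q x‖ =
      √(2 * laplaceFun μ 0 - 2 * laplaceFun μ (∑ i, |x i - y i| ^ q)) := fun y => by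
    rw [← Real.sqrt_sq (norm_nonneg (kernelFeature μ q y - _)), norm_sub_sq_real,
      norm_kernelFeature_sq, norm_kernelFeature_sq, inner_kernelFeature,
      kernelFeature_apply]
    congr 1
    ring
  simp only [h]
  have hc : Continuous (laplaceFun μ) := by
    rw [← laplaceMoment_zero]
    exact continuous_laplaceMoment hT 0
  have hcont : Continuous fun y : Fin p → ℝ =>
      √(2 * laplaceFun μ 0 - 2 * laplaceFun μ (∑ i, |x i - y i| ^ q)) := by
    fun_prop
  have := hcont.tendsto x
  simpa [hq0] using this

theorem continuous_coe {T : ℝ} (hT : ∀ᵐ t : ℝ≥0 ∂μ, (t : ℝ) ≤ T) (f : KernelSpace μ q p) :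
    Continuous f := by
  have : (f : (Fin p → ℝ) → ℝ) = fun x => ⟪kernelFeature μ q x, f⟫_ℝ :=
    funext fun x => (inner_kernelFeature x f).symm
  rw [this]
  exact (continuous_kernelFeature hT).inner continuous_const

theorem measurable_rescale (q : ℕ) (β : Fin p → ℝ) : Measurable (rescale q β) := by
  unfold rescale
  fun_prop

theorem inner_kernelFeature_rescale {β : Fin p → ℝ} (hβ : ∀ i, 0 ≤ β i)
    (w : ((Fin p → ℝ) × ℝ) × ((Fin p → ℝ) × ℝ)) :
    ⟪kernelFeature μ q (rescale q β w.1.1), kernelFeature μ q (rescale q β w.2.1)⟫_ℝ =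
      pairKernel μ 0 q β w := by
  rw [inner_kernelFeature, kernelFeature_apply, pairKernel, laplaceMoment_zero]
  congr 1
  refine Finset.sum_congr rfl fun i _ => ?_
  rw [abs_rescale_sub_pow hq.out hβ, abs_sub_comm]
  rfl

theorem measurable_inner_kernelFeature {T : ℝ} (hT : ∀ᵐ t : ℝ≥0 ∂μ, (t : ℝ) ≤ T)
    (β : Fin p → ℝ) (f : KernelSpace μ q p) :
    Measurable fun z : (Fin p → ℝ) × ℝ => ⟪kernelFeature μ q (rescale q β z.1), f⟫_ℝ := by
  simp only [inner_kernelFeature]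
  exact (continuous_coe hT f).measurable.comp ((measurable_rescale q β).comp measurable_fst)

/-- The pair kernel is positive semidefinite. -/
theorem crossForm_pairKernel_nonneg {T : ℝ} (hT : ∀ᵐ t : ℝ≥0 ∂μ, (t : ℝ) ≤ T)
    {Q : Measure ((Fin p → ℝ) × ℝ)} [IsProbabilityMeasure Q]
    {β : Fin p → ℝ} (hβ : ∀ i, 0 ≤ β i) {s : (Fin p → ℝ) × ℝ → ℝ} (hs : MemLp s ⊤ Q) :
    0 ≤ crossForm Q (pairKernel μ 0 q β) s s := by
  have h := crossForm_featureKernel_nonneg (Q := Q)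
    (Φ := fun z : (Fin p → ℝ) × ℝ => kernelFeature μ q (rescale q β z.1))
    (fun z => (norm_kernelFeature _).le) (measurable_inner_kernelFeature hT β)
    (by
      simp only [inner_kernelFeature_rescale hβ]
      exact measurable_pairKernel hT 0 q β) hs
  simpa only [inner_kernelFeature_rescale hβ] using h

/-- `r` is the residual of the kernel ridge regression with weights `β`. -/
structure IsResidual (μ : Measure ℝ≥0) [IsFiniteMeasure μ] (q : ℕ) [Fact (q = 1 ∨ q = 2)]
    (Q : Measure ((Fin p → ℝ) × ℝ)) (lam : ℝ) (β : Fin p → ℝ)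
    (r : (Fin p → ℝ) × ℝ → ℝ) : Prop where
  memLp : MemLp r ⊤ Q
  euler : ∀ s, MemLp s ⊤ Q → lam * ∫ z, s z * r z ∂Q + crossForm Q (pairKernel μ 0 q β) s r =
    lam * ∫ z, s z * z.2 ∂Q
  value : krrObjective μ q Q lam β = (1 / 2) * ∫ z, z.2 * r z ∂Q
  feature : ∃ g : (Fin p → ℝ) → ℝ, Measurable g ∧ (∃ C, ∀ x, |g x| ≤ C) ∧
    ∀ z, r z = z.2 - g (rescale q β z.1)

/-- The normal equation tested with `k(x, ·)` reads `∫ r k(x, ·) dQ = lam f(x)`; integrating it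
against `s` eliminates the Hilbert space. Residuals for different weights then live in the same
`L^∞(Q)` and can be compared. -/
theorem exists_isResidual {T : ℝ} (hT : ∀ᵐ t : ℝ≥0 ∂μ, (t : ℝ) ≤ T)
    {Q : Measure ((Fin p → ℝ) × ℝ)} [IsProbabilityMeasure Q]
    (hY : MemLp (fun z : (Fin p → ℝ) × ℝ => z.2) ⊤ Q) {lam : ℝ} (hlam : 0 < lam)
    {β : Fin p → ℝ} (hβ : ∀ i, 0 ≤ β i) :
    ∃ r, IsResidual μ q Q lam β r := by
  have hC : ∀ z : (Fin p → ℝ) × ℝ, ‖kernelFeature μ q (rescale q β z.1)‖ ≤ √(laplaceFun μ 0) :=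
    fun z => (norm_kernelFeature _).le
  have hm := measurable_inner_kernelFeature (q := q) hT β
  obtain ⟨f, hf⟩ := exists_ridge_minimizer hC hm hY hlam
  have hval := ridge_value hC hm hY hlam hf
  have hr : MemLp (fun z : (Fin p → ℝ) × ℝ => z.2 - f (rescale q β z.1)) ⊤ Q := by
    have := hY.sub (memLp_top_inner_feature hC hm f)
    simp only [inner_kernelFeature] at this
    exact this
  simp only [inner_kernelFeature] at hval
  refine ⟨fun z => z.2 - f (rescale q β z.1), hr, fun s hs => ?_, hval,
    f, (continuous_coe hT f).measurable, ⟨‖f‖ * √(laplaceFun μ 0), fun x => ?_⟩, fun z => rfl⟩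
  · rw [crossForm_eq_integral_integral (memLp_top_pairKernel hT 0 q hβ _) hs hr]
    have h1 : ∀ z : (Fin p → ℝ) × ℝ, ∫ z', (z'.2 - f (rescale q β z'.1)) *
        pairKernel μ 0 q β (z, z') ∂Q = lam * f (rescale q β z.1) := fun z => by
      rw [← inner_kernelFeature, real_inner_comm, hf]
      refine integral_congr_ae (.of_forall fun z' => ?_)
      have := inner_kernelFeature_rescale (μ := μ) (q := q) hβ (z', z)
      simp only at this
      simp only [this, inner_kernelFeature]
      rw [← pairKernel_swap]
      rfl
    simp only [h1]
    rw [← integral_const_mul, ← integral_const_mul, ← integral_add]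
    · exact integral_congr_ae (.of_forall fun z => by ring)
    · exact (hs.mul_top hr).integrable_top.const_mul _
    · have h2 : MemLp (fun z : (Fin p → ℝ) × ℝ => f (rescale q β z.1)) ⊤ Q := by
        simpa only [inner_kernelFeature] using memLp_top_inner_feature hC hm f
      exact (hs.mul_top (h2.const_mul lam)).integrable_top
  · rw [← inner_kernelFeature, ← norm_kernelFeature (μ := μ) (q := q) x, mul_comm]
    exact norm_inner_le_norm (𝕜 := ℝ) (kernelFeature μ q x) f

theorem krrObjective_nonneg (Q : Measure ((Fin p → ℝ) × ℝ)) {lam : ℝ} (hlam : 0 < lam)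
    (β : Fin p → ℝ) : 0 ≤ krrObjective μ q Q lam β :=
  Real.iInf_nonneg fun f => add_nonneg
    (mul_nonneg (by norm_num) (integral_nonneg fun z => sq_nonneg _)) (by positivity)

theorem krrObjective_le (Q : Measure ((Fin p → ℝ) × ℝ)) {lam : ℝ} (hlam : 0 < lam)
    (β : Fin p → ℝ) (f : KernelSpace μ q p) : krrObjective μ q Q lam β ≤
      (1 / 2) * ∫ z, (z.2 - f (rescale q β z.1)) ^ 2 ∂Q + lam / 2 * ‖f‖ ^ 2 :=
  ciInf_le ⟨0, by
    rintro _ ⟨f, rfl⟩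
    exact add_nonneg (mul_nonneg (by norm_num) (integral_nonneg fun z => sq_nonneg _))
      (by positivity)⟩ f

end KernelSpace

end SelfPen

/-! ### Regularity of the objective in the weights. -/

namespace SelfPen

variable {p : ℕ}

/-- A common bound for the data and for the moments of the kernel. -/
structure CommonBound (μ : Measure ℝ≥0) (q : ℕ) (Q : Measure ((Fin p → ℝ) × ℝ)) (C : ℝ) :
    Prop where
  one_le : 1 ≤ C
  response : ∀ᵐ z ∂Q, |z.2| ≤ C
  coordGap_le : ∀ᵐ w ∂(Q.prod Q), ∀ j, coordGap q j w ≤ C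
  moment : ∀ n ≤ 2, laplaceMoment μ n 0 ≤ C
  mass_bdd : ∀ᵐ t : ℝ≥0 ∂μ, (t : ℝ) ≤ C

theorem exists_commonBound {μ : Measure ℝ≥0} (hμ : KernelAssumption μ)
    (q : ℕ) {Q : Measure ((Fin p → ℝ) × ℝ)} [IsProbabilityMeasure Q]
    (hQ : DistributionAssumption Q) : ∃ C, CommonBound μ q Q C := by
  obtain ⟨_, T, _, hT⟩ := hμ.ae_mem
  obtain ⟨A, B, hAB⟩ := hQ.bounded
  set L : ℝ := |laplaceMoment μ 0 0| + |laplaceMoment μ 1 0| + |laplaceMoment μ 2 0|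
  set C : ℝ := 1 + |T| + |B| + (2 * |A|) ^ q + L with hC
  have hT0 := abs_nonneg T
  have hB0 := abs_nonneg B
  have hA0 : 0 ≤ (2 * |A|) ^ q := by positivity
  have hL0 : 0 ≤ L := by positivity
  refine ⟨C, by linarith, ?_, ?_, ?_, ?_⟩
  · filter_upwards [hAB] with z hz
    have := hz.2.trans (le_abs_self B)
    linarith
  · filter_upwards [measurePreserving_fst.quasiMeasurePreserving.ae hAB,
      measurePreserving_snd.quasiMeasurePreserving.ae hAB] with w h1 h2 j
    have h3 : |w.1.1 j - w.2.1 j| ≤ 2 * |A| := by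
      have := abs_sub (w.1.1 j) (w.2.1 j)
      have := h1.1 j
      have := h2.1 j
      have := le_abs_self A
      linarith
    have : coordGap q j w ≤ (2 * |A|) ^ q := pow_le_pow_left₀ (abs_nonneg _) h3 q
    linarith
  · intro n hn
    have h0 := abs_nonneg (laplaceMoment μ 0 0)
    have h1 := abs_nonneg (laplaceMoment μ 1 0)
    have h2 := abs_nonneg (laplaceMoment μ 2 0)
    have : laplaceMoment μ n 0 ≤ L := by
      interval_cases n
      · have := le_abs_self (laplaceMoment μ 0 0); simp only [L]; linarith
      · have := le_abs_self (laplaceMoment μ 1 0); simp only [L]; linarith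
      · have := le_abs_self (laplaceMoment μ 2 0); simp only [L]; linarith
    linarith
  · filter_upwards [hT] with t ht
    have := ht.2.trans (le_abs_self T)
    linarith

section
variable {μ : Measure ℝ≥0} [IsFiniteMeasure μ] {q : ℕ} {Q : Measure ((Fin p → ℝ) × ℝ)} {C : ℝ}

omit [IsFiniteMeasure μ] in
theorem CommonBound.memLp_response (hC : CommonBound μ q Q C) :
    MemLp (fun z : (Fin p → ℝ) × ℝ => z.2) ⊤ Q :=
  memLp_top_of_bound measurable_snd.aestronglyMeasurable C hC.response

omit [IsFiniteMeasure μ] in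
theorem CommonBound.memLp_coordGap (hC : CommonBound μ q Q C) (j : Fin p) :
    MemLp (coordGap q j) ⊤ (Q.prod Q) :=
  memLp_top_of_bound (measurable_coordGap q j).aestronglyMeasurable C
    (hC.coordGap_le.mono fun w hw => by
      rw [Real.norm_of_nonneg (coordGap_nonneg _ _ _)]
      exact hw j)

theorem abs_weightedGap_sub_le {w : ((Fin p → ℝ) × ℝ) × ((Fin p → ℝ) × ℝ)}
    (hw : ∀ j, coordGap q j w ≤ C) (β γ : Fin p → ℝ) :
    |weightedGap q γ w - weightedGap q β w| ≤ C * ∑ i, |γ i - β i| := by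
  rw [weightedGap, weightedGap, ← Finset.sum_sub_distrib, Finset.mul_sum]
  refine (Finset.abs_sum_le_sum_abs _ _).trans (Finset.sum_le_sum fun i _ => ?_)
  rw [← sub_mul, abs_mul, abs_of_nonneg (coordGap_nonneg q i w), mul_comm]
  exact mul_le_mul_of_nonneg_right (hw i) (abs_nonneg _)

theorem CommonBound.abs_pairKernel_sub_le (hC : CommonBound μ q Q C) {n : ℕ} (hn : n ≤ 1)
    {β γ : Fin p → ℝ} (hβ : ∀ i, 0 ≤ β i) (hγ : ∀ i, 0 ≤ γ i) :
    ∀ᵐ w ∂(Q.prod Q), |pairKernel μ n q γ w - pairKernel μ n q β w| ≤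
      C ^ 2 * ∑ i, |γ i - β i| := by
  have hC1 := hC.one_le
  filter_upwards [hC.coordGap_le] with w hw
  refine (abs_laplaceMoment_sub_le hC.mass_bdd n (weightedGap_nonneg q hβ w)
    (weightedGap_nonneg q hγ w)).trans ?_
  rw [sq, mul_assoc]
  exact mul_le_mul (hC.moment _ (by omega)) (abs_weightedGap_sub_le hw β γ) (abs_nonneg _)
    (by linarith)

theorem CommonBound.abs_pairKernel_taylor_le (hC : CommonBound μ q Q C)
    {β γ : Fin p → ℝ} (hβ : ∀ i, 0 ≤ β i) (hγ : ∀ i, 0 ≤ γ i) :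
    ∀ᵐ w ∂(Q.prod Q), |pairKernel μ 0 q γ w - pairKernel μ 0 q β w +
      pairKernel μ 1 q β w * weightedGap q (γ - β) w| ≤ C ^ 3 * (∑ i, |γ i - β i|) ^ 2 := by
  have hC1 := hC.one_le
  filter_upwards [hC.coordGap_le] with w hw
  have h := abs_laplaceMoment_sub_add_le hC.mass_bdd 0 (weightedGap_nonneg q hβ w)
    (weightedGap_nonneg q hγ w)
  have e : weightedGap q (γ - β) w = weightedGap q γ w - weightedGap q β w := by
    simp [weightedGap, sub_mul]
  rw [e]
  refine h.trans ?_
  have h2 : (weightedGap q γ w - weightedGap q β w) ^ 2 ≤ (C * ∑ i, |γ i - β i|) ^ 2 :=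
    sq_le_sq' (by linarith [abs_le.1 (abs_weightedGap_sub_le hw β γ)])
      (abs_le.1 (abs_weightedGap_sub_le hw β γ)).2
  calc _ ≤ C * (C * ∑ i, |γ i - β i|) ^ 2 :=
        mul_le_mul (hC.moment 2 le_rfl) h2 (sq_nonneg _) (by linarith)
    _ = _ := by ring

/-- The kernel of the partial derivative in direction `j`. -/
noncomputable def gradKernel (μ : Measure ℝ≥0) (q : ℕ) (β : Fin p → ℝ) (j : Fin p)
    (w : ((Fin p → ℝ) × ℝ) × ((Fin p → ℝ) × ℝ)) : ℝ :=
  pairKernel μ 1 q β w * coordGap q j w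

theorem CommonBound.memLp_gradKernel (hC : CommonBound μ q Q C) {β : Fin p → ℝ}
    (hβ : ∀ i, 0 ≤ β i) (j : Fin p) : MemLp (gradKernel μ q β j) ⊤ (Q.prod Q) :=
  (memLp_top_pairKernel hC.mass_bdd 1 q hβ _).mul_top (hC.memLp_coordGap j)

theorem CommonBound.abs_gradKernel_le (hC : CommonBound μ q Q C) {β : Fin p → ℝ}
    (hβ : ∀ i, 0 ≤ β i) (j : Fin p) : ∀ᵐ w ∂(Q.prod Q), |gradKernel μ q β j w| ≤ C ^ 2 := by
  have hC1 := hC.one_le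
  filter_upwards [hC.coordGap_le] with w hw
  rw [gradKernel, abs_mul, abs_of_nonneg (coordGap_nonneg _ _ _),
    abs_of_nonneg (pairKernel_nonneg _ _ _ _ _), sq]
  exact mul_le_mul ((pairKernel_le hC.mass_bdd 1 q hβ w).trans (hC.moment 1 (by norm_num)))
    (hw j) (coordGap_nonneg _ _ _) (by linarith)

theorem CommonBound.abs_gradKernel_sub_le (hC : CommonBound μ q Q C) {β γ : Fin p → ℝ}
    (hβ : ∀ i, 0 ≤ β i) (hγ : ∀ i, 0 ≤ γ i) (j : Fin p) :
    ∀ᵐ w ∂(Q.prod Q), |gradKernel μ q γ j w - gradKernel μ q β j w| ≤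
      C ^ 3 * ∑ i, |γ i - β i| := by
  have hC1 := hC.one_le
  filter_upwards [hC.coordGap_le, hC.abs_pairKernel_sub_le le_rfl hβ hγ] with w hw h
  rw [gradKernel, gradKernel, ← sub_mul, abs_mul, abs_of_nonneg (coordGap_nonneg _ _ _)]
  calc _ ≤ (C ^ 2 * ∑ i, |γ i - β i|) * C :=
        mul_le_mul h (hw j) (coordGap_nonneg _ _ _)
          (mul_nonneg (by positivity) (Finset.sum_nonneg fun i _ => abs_nonneg _))
    _ = _ := by ring

end

section
variable {μ : Measure ℝ≥0} [IsFiniteMeasure μ] {q : ℕ} [Fact (q = 1 ∨ q = 2)]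
  {Q : Measure ((Fin p → ℝ) × ℝ)} [IsProbabilityMeasure Q] {C lam : ℝ} {β γ : Fin p → ℝ}
  {r s : (Fin p → ℝ) × ℝ → ℝ}

/-- Testing the residual equation with `r` and dropping the nonnegative form gives `E[r²] ≤ E[r Y] ≤
C E|r|`, and `(E|r|)² ≤ E[r²]`. The bound does not depend on `lam` or `β`. -/
theorem IsResidual.integral_abs_le (hr : IsResidual μ q Q lam β r) (hC : CommonBound μ q Q C)
    (hlam : 0 < lam) (hβ : ∀ i, 0 ≤ β i) : ∫ z, |r z| ∂Q ≤ C := by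
  have h1 := sq_integral_abs_le hr.memLp
  have h2 := hr.euler r hr.memLp
  have h3 := crossForm_pairKernel_nonneg (q := q) hC.mass_bdd hβ hr.memLp
  have h4 : ∫ z, r z * z.2 ∂Q ≤ (∫ z, |r z| ∂Q) * C := by
    rw [← integral_mul_const]
    refine integral_mono_ae (hr.memLp.mul_top hC.memLp_response).integrable_top
      (hr.memLp.abs_top.integrable_top.mul_const C) ?_
    filter_upwards [hC.response] with z hz
    refine (le_abs_self _).trans ?_
    rw [abs_mul]
    exact mul_le_mul_of_nonneg_left hz (abs_nonneg _)
  have h5 : ∫ z, r z * r z ∂Q ≤ ∫ z, r z * z.2 ∂Q :=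
    le_of_mul_le_mul_left (by linarith) hlam
  have h6 : 0 ≤ ∫ z, |r z| ∂Q := integral_nonneg fun z => abs_nonneg _
  have hC1 := hC.one_le
  by_contra! h
  nlinarith

/-- Subtract the two residual equations and test with `s - r`. The form of the kernel at `γ` has a
sign; what remains is the difference of kernels paired with `s - r` and `r`, at the price of a
factor `1/lam`. -/
theorem IsResidual.integral_abs_sub_le (hr : IsResidual μ q Q lam β r)
    (hs : IsResidual μ q Q lam γ s) (hC : CommonBound μ q Q C)
    (hlam : 0 < lam) (hβ : ∀ i, 0 ≤ β i) (hγ : ∀ i, 0 ≤ γ i) :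
    ∫ z, |s z - r z| ∂Q ≤ C ^ 3 * (∑ i, |γ i - β i|) / lam := by
  have hd : MemLp (fun z => s z - r z) ⊤ Q := hs.memLp.sub hr.memLp
  have kβ := memLp_top_pairKernel hC.mass_bdd 0 q hβ (Q.prod Q)
  have kγ := memLp_top_pairKernel hC.mass_bdd 0 q hγ (Q.prod Q)
  have h1 := hr.euler _ hd
  have h2 := hs.euler _ hd
  have h3 := crossForm_pairKernel_nonneg (q := q) hC.mass_bdd hγ hd
  have h4 := sq_integral_abs_le hd
  have h5 : ∫ z, (s z - r z) * (s z - r z) ∂Q =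
      ∫ z, (s z - r z) * s z ∂Q - ∫ z, (s z - r z) * r z ∂Q := by
    rw [← integral_sub (hd.mul_top hs.memLp).integrable_top (hd.mul_top hr.memLp).integrable_top]
    exact integral_congr_ae (.of_forall fun z => by ring)
  have h6 := crossForm_sub_right kγ hd hs.memLp hr.memLp
  have h7 := crossForm_kernel_sub kγ kβ hd hr.memLp
  have h8 := abs_crossForm_le (hC.abs_pairKernel_sub_le zero_le_one hβ hγ) hd hr.memLp
  have h9 := hr.integral_abs_le hC hlam hβ
  have hC1 := hC.one_le
  set a := ∫ z, |s z - r z| ∂Q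
  have ha : 0 ≤ a := integral_nonneg fun z => abs_nonneg _
  set σ := ∑ i, |γ i - β i|
  have hσ : 0 ≤ σ := Finset.sum_nonneg fun i _ => abs_nonneg _
  have h10 : lam * a ^ 2 ≤ C ^ 3 * σ * a := by
    calc lam * a ^ 2 ≤ lam * ∫ z, (s z - r z) * (s z - r z) ∂Q :=
          mul_le_mul_of_nonneg_left h4 hlam.le
      _ ≤ |crossForm Q (fun w => pairKernel μ 0 q γ w - pairKernel μ 0 q β w)
            (fun z => s z - r z) r| := by
          refine le_trans ?_ (neg_le_abs _)
          rw [h7, h5]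
          linarith
      _ ≤ C ^ 2 * σ * (a * C) :=
          h8.trans (by gcongr)
      _ = _ := by ring
  rw [le_div_iff₀ hlam]
  by_contra! h
  have : 0 < a := by
    rcases ha.eq_or_lt with h0 | h0
    · rw [← h0, zero_mul] at h
      have : 0 ≤ C ^ 3 * σ := by positivity
      linarith
    · exact h0
  nlinarith

/-- Test the equation at `β` with `s`, the one at `γ` with `r`, and subtract: by symmetry `E[r s]`
cancels. The identity is exact, with no remainder to estimate. -/
theorem IsResidual.krrObjective_sub (hr : IsResidual μ q Q lam β r)
    (hs : IsResidual μ q Q lam γ s) (hC : CommonBound μ q Q C)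
    (hlam : 0 < lam) (hβ : ∀ i, 0 ≤ β i) (hγ : ∀ i, 0 ≤ γ i) :
    krrObjective μ q Q lam γ - krrObjective μ q Q lam β = -(1 / (2 * lam)) *
      crossForm Q (fun w => pairKernel μ 0 q γ w - pairKernel μ 0 q β w) r s := by
  have kβ := memLp_top_pairKernel hC.mass_bdd 0 q hβ (Q.prod Q)
  have kγ := memLp_top_pairKernel hC.mass_bdd 0 q hγ (Q.prod Q)
  have h1 := hr.euler _ hs.memLp
  have h2 := hs.euler _ hr.memLp
  rw [crossForm_kernel_sub kγ kβ hr.memLp hs.memLp, hr.value, hs.value]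
  rw [crossForm_comm (pairKernel_swap μ 0 q β)] at h1
  have h3 : ∫ z, s z * r z ∂Q = ∫ z, r z * s z ∂Q := by simp only [mul_comm]
  have h4 : ∫ z, s z * z.2 ∂Q = ∫ z, z.2 * s z ∂Q := by simp only [mul_comm]
  have h5 : ∫ z, r z * z.2 ∂Q = ∫ z, z.2 * r z ∂Q := by simp only [mul_comm]
  rw [h3, h4] at h1
  rw [h5] at h2
  field_simp
  linarith

theorem IsResidual.abs_krrObjective_sub_le (hr : IsResidual μ q Q lam β r)
    (hs : IsResidual μ q Q lam γ s) (hC : CommonBound μ q Q C)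
    (hlam : 0 < lam) (hβ : ∀ i, 0 ≤ β i) (hγ : ∀ i, 0 ≤ γ i) :
    |krrObjective μ q Q lam γ - krrObjective μ q Q lam β| ≤
      C ^ 4 / lam * ∑ i, |γ i - β i| := by
  have hC1 := hC.one_le
  rw [hr.krrObjective_sub hs hC hlam hβ hγ, abs_mul, abs_neg, abs_of_pos (by positivity)]
  have h := abs_crossForm_le (hC.abs_pairKernel_sub_le zero_le_one hβ hγ) hr.memLp hs.memLp
  have h1 := hr.integral_abs_le hC hlam hβ
  have h2 := hs.integral_abs_le hC hlam hγ
  have h3 : 0 ≤ ∫ z, |s z| ∂Q := integral_nonneg fun z => abs_nonneg _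
  set σ := ∑ i, |γ i - β i|
  have hσ : 0 ≤ σ := Finset.sum_nonneg fun i _ => abs_nonneg _
  calc _ ≤ 1 / (2 * lam) * (C ^ 2 * σ * (C * C)) := by
        refine mul_le_mul_of_nonneg_left (h.trans ?_) (by positivity)
        gcongr
    _ = C ^ 4 / lam * σ / 2 := by field_simp
    _ ≤ _ := half_le_self (by positivity)

/-- The partial derivatives of the objective, in terms of the residual. -/
noncomputable def krrGradient (μ : Measure ℝ≥0) (q : ℕ) (Q : Measure ((Fin p → ℝ) × ℝ))
    (lam : ℝ) (β : Fin p → ℝ) (r : (Fin p → ℝ) × ℝ → ℝ) (j : Fin p) : ℝ :=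
  1 / (2 * lam) * crossForm Q (gradKernel μ q β j) r r

theorem IsResidual.sum_krrGradient (hr : IsResidual μ q Q lam β r) (hC : CommonBound μ q Q C)
    (hβ : ∀ i, 0 ≤ β i) (η : Fin p → ℝ) :
    ∑ j, η j * krrGradient μ q Q lam β r j = 1 / (2 * lam) *
      crossForm Q (fun w => pairKernel μ 1 q β w * weightedGap q η w) r r := by
  simp only [krrGradient, crossForm, mul_left_comm _ (1 / (2 * lam)), ← Finset.mul_sum]
  congr 1
  simp only [← integral_const_mul]
  rw [← integral_finsetSum]
  · refine integral_congr_ae (.of_forall fun w => ?_)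
    simp only [gradKernel, weightedGap, Finset.mul_sum]
    exact Finset.sum_congr rfl fun j _ => by ring
  · exact fun j _ => (integrable_crossForm (hC.memLp_gradKernel hβ j) hr.memLp hr.memLp).const_mul _

/-- Two errors of second order: replacing `s` by `r` in the increment formula (first order in the
kernel times first order in the residual), and the Taylor remainder of `h`. Each is at most `C^6 σ²
/ lam`, with `σ` the `ℓ₁` distance; the prefactor `1/(2 lam)` gives the constant. -/
theorem IsResidual.abs_krrObjective_taylor_le (hr : IsResidual μ q Q lam β r)
    (hs : IsResidual μ q Q lam γ s) (hC : CommonBound μ q Q C)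
    (hlam : 0 < lam) (hlam1 : lam ≤ 1) (hβ : ∀ i, 0 ≤ β i) (hγ : ∀ i, 0 ≤ γ i) :
    |krrObjective μ q Q lam γ - krrObjective μ q Q lam β -
        ∑ j, (γ j - β j) * krrGradient μ q Q lam β r j| ≤
      C ^ 6 / lam ^ 2 * (∑ i, |γ i - β i|) ^ 2 := by
  have hC1 := hC.one_le
  have kβ := memLp_top_pairKernel hC.mass_bdd 0 q hβ (Q.prod Q)
  have kγ := memLp_top_pairKernel hC.mass_bdd 0 q hγ (Q.prod Q)
  have kd : MemLp (fun w => pairKernel μ 0 q γ w - pairKernel μ 0 q β w) ⊤ (Q.prod Q) :=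
    kγ.sub kβ
  have k1 := memLp_top_pairKernel hC.mass_bdd 1 q hβ (Q.prod Q)
  have hd : MemLp (fun z => s z - r z) ⊤ Q := hs.memLp.sub hr.memLp
  have hg : MemLp (weightedGap q (γ - β)) ⊤ (Q.prod Q) := by
    unfold weightedGap
    exact memLp_finsetSum _ fun i _ => (hC.memLp_coordGap i).const_mul _
  have h1 := crossForm_kernel_sub (κ := fun w => pairKernel μ 0 q γ w - pairKernel μ 0 q β w)
    (κ' := fun w => -1 * (pairKernel μ 1 q β w * weightedGap q (γ - β) w)) kd
    ((k1.mul_top hg).const_mul (-1)) hr.memLp hr.memLp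
  have h2 := crossForm_sub_right kd hr.memLp hs.memLp hr.memLp
  have h3 := abs_crossForm_le (κ := fun w => (pairKernel μ 0 q γ w - pairKernel μ 0 q β w) -
      (-1 * (pairKernel μ 1 q β w * weightedGap q (γ - β) w)))
    (C := C ^ 3 * (∑ i, |γ i - β i|) ^ 2) (by
      simpa only [neg_one_mul, sub_neg_eq_add] using hC.abs_pairKernel_taylor_le hβ hγ)
    hr.memLp hr.memLp
  have h4 := abs_crossForm_le (hC.abs_pairKernel_sub_le zero_le_one hβ hγ) hr.memLp hd
  have h5 := hr.integral_abs_le hC hlam hβ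
  have h6 := hr.integral_abs_sub_le hs hC hlam hβ hγ
  have h7 : crossForm Q (fun w => -1 * (pairKernel μ 1 q β w * weightedGap q (γ - β) w)) r r =
      - crossForm Q (fun w => pairKernel μ 1 q β w * weightedGap q (γ - β) w) r r := by
    simp only [crossForm, neg_one_mul, mul_neg]
    exact integral_neg _
  have h8 := hr.sum_krrGradient hC hβ (γ - β)
  simp only [Pi.sub_apply] at h8
  rw [h8, hr.krrObjective_sub hs hC hlam hβ hγ]
  have h9 : 0 ≤ ∫ z, |r z| ∂Q := integral_nonneg fun z => abs_nonneg _
  have h10 : 0 ≤ ∫ z, |s z - r z| ∂Q := integral_nonneg fun z => abs_nonneg _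
  set σ := ∑ i, |γ i - β i|
  have hσ : 0 ≤ σ := Finset.sum_nonneg fun i _ => abs_nonneg _
  set A := crossForm Q (fun w => pairKernel μ 0 q γ w - pairKernel μ 0 q β w) r s
  set A' := crossForm Q (fun w => pairKernel μ 0 q γ w - pairKernel μ 0 q β w) r r
  set G := crossForm Q (fun w => pairKernel μ 1 q β w * weightedGap q (γ - β) w) r r
  rw [h1, h7, sub_neg_eq_add] at h3
  rw [h2] at h4
  have h11 : |A' + G| ≤ C ^ 3 * σ ^ 2 * (C * C) := h3.trans (by gcongr)
  have h12 : |A - A'| ≤ C ^ 2 * σ * (C * (C ^ 3 * σ / lam)) := h4.trans (by gcongr)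
  have h13 : |A + G| ≤ C ^ 3 * σ ^ 2 * (C * C) + C ^ 2 * σ * (C * (C ^ 3 * σ / lam)) := by
    have := abs_add_le (A - A') (A' + G)
    have e : A - A' + (A' + G) = A + G := by ring
    rw [e] at this
    linarith
  have h14 : C ^ 3 * σ ^ 2 * (C * C) ≤ C ^ 6 * σ ^ 2 / lam := by
    rw [le_div_iff₀ hlam]
    calc C ^ 3 * σ ^ 2 * (C * C) * lam = C ^ 5 * σ ^ 2 * lam := by ring
      _ ≤ C ^ 6 * σ ^ 2 * 1 := by
        gcongr
        norm_num
      _ = _ := by ring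
  calc |-(1 / (2 * lam)) * A - 1 / (2 * lam) * G| = 1 / (2 * lam) * |A + G| := by
        rw [← abs_of_pos (show 0 < 1 / (2 * lam) by positivity), ← abs_mul,
          abs_of_pos (show 0 < 1 / (2 * lam) by positivity), ← abs_neg]
        congr 1
        ring
    _ ≤ 1 / (2 * lam) * (C ^ 6 * σ ^ 2 / lam + C ^ 6 * σ ^ 2 / lam) := by
        refine mul_le_mul_of_nonneg_left (h13.trans (add_le_add h14 (le_of_eq ?_))) (by positivity)
        ring
    _ = _ := by field_simp; ring

/-- Exchange the residual in either slot, then the kernel. Each exchange costs at most `C^6 σ /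
lam`, with `σ` the `ℓ₁` distance; the three are rounded up to four so that the constant is twice
that of the Taylor bound. -/
theorem IsResidual.abs_krrGradient_sub_le (hr : IsResidual μ q Q lam β r)
    (hs : IsResidual μ q Q lam γ s) (hC : CommonBound μ q Q C)
    (hlam : 0 < lam) (hlam1 : lam ≤ 1) (hβ : ∀ i, 0 ≤ β i) (hγ : ∀ i, 0 ≤ γ i) (j : Fin p) :
    |krrGradient μ q Q lam γ s j - krrGradient μ q Q lam β r j| ≤
      2 * C ^ 6 / lam ^ 2 * ∑ i, |γ i - β i| := by
  have hC1 := hC.one_le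
  have kβ := hC.memLp_gradKernel hβ j
  have kγ := hC.memLp_gradKernel hγ j
  have hd : MemLp (fun z => s z - r z) ⊤ Q := hs.memLp.sub hr.memLp
  have h1 := crossForm_sub_right kγ hs.memLp hs.memLp hr.memLp
  have h2 := crossForm_sub_left kγ hs.memLp hr.memLp hr.memLp
  have h3 := crossForm_kernel_sub kγ kβ hr.memLp hr.memLp
  have b1 := abs_crossForm_le (hC.abs_gradKernel_le hγ j) hs.memLp hd
  have b2 := abs_crossForm_le (hC.abs_gradKernel_le hγ j) hd hr.memLp
  have b3 := abs_crossForm_le (hC.abs_gradKernel_sub_le hβ hγ j) hr.memLp hr.memLp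
  have h5 := hr.integral_abs_le hC hlam hβ
  have h5' := hs.integral_abs_le hC hlam hγ
  have h6 := hr.integral_abs_sub_le hs hC hlam hβ hγ
  have h9 : 0 ≤ ∫ z, |r z| ∂Q := integral_nonneg fun z => abs_nonneg _
  have h9' : 0 ≤ ∫ z, |s z| ∂Q := integral_nonneg fun z => abs_nonneg _
  have h10 : 0 ≤ ∫ z, |s z - r z| ∂Q := integral_nonneg fun z => abs_nonneg _
  set σ := ∑ i, |γ i - β i|
  have hσ : 0 ≤ σ := Finset.sum_nonneg fun i _ => abs_nonneg _
  rw [h1] at b1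
  rw [h2] at b2
  rw [h3] at b3
  have c1 := b1.trans (show _ ≤ C ^ 2 * (C * (C ^ 3 * σ / lam)) by gcongr)
  have c2 := b2.trans (show _ ≤ C ^ 2 * ((C ^ 3 * σ / lam) * C) by gcongr)
  have c3 := b3.trans (show _ ≤ C ^ 3 * σ * (C * C) by gcongr)
  have c4 : C ^ 3 * σ * (C * C) ≤ C ^ 6 * σ / lam := by
    rw [le_div_iff₀ hlam]
    calc C ^ 3 * σ * (C * C) * lam = C ^ 5 * σ * lam := by ring
      _ ≤ C ^ 6 * σ * 1 := by
        gcongr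
        norm_num
      _ = _ := by ring
  rw [krrGradient, krrGradient, ← mul_sub, abs_mul, abs_of_pos (by positivity)]
  set A := crossForm Q (gradKernel μ q γ j) s s
  set A₁ := crossForm Q (gradKernel μ q γ j) s r
  set A₂ := crossForm Q (gradKernel μ q γ j) r r
  set A₃ := crossForm Q (gradKernel μ q β j) r r
  have c5 : |A - A₃| ≤ 4 * (C ^ 6 * σ / lam) := by
    have e1 : C ^ 2 * (C * (C ^ 3 * σ / lam)) = C ^ 6 * σ / lam := by ring
    have e2 : C ^ 2 * ((C ^ 3 * σ / lam) * C) = C ^ 6 * σ / lam := by ring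
    have e3 : 0 ≤ C ^ 6 * σ / lam := by positivity
    rw [e1] at c1
    rw [e2] at c2
    have := abs_le.1 c1
    have := abs_le.1 c2
    have := abs_le.1 c3
    rw [abs_le]
    constructor <;> linarith
  calc 1 / (2 * lam) * |A - A₃| ≤ 1 / (2 * lam) * (4 * (C ^ 6 * σ / lam)) := by gcongr
    _ = _ := by field_simp; ring

end

end SelfPen

/-! ### Kernel energy of the residual. -/

namespace SelfPen

variable {p : ℕ}

section
variable {μ : Measure ℝ≥0} [IsFiniteMeasure μ] {q : ℕ} [Fact (q = 1 ∨ q = 2)]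
  {Q : Measure ((Fin p → ℝ) × ℝ)} [IsProbabilityMeasure Q] {C lam : ℝ} {β : Fin p → ℝ}
  {r s : (Fin p → ℝ) × ℝ → ℝ}

omit [IsProbabilityMeasure Q] in
theorem IsResidual.krrObjective_eq (hr : IsResidual μ q Q lam β r) (hC : CommonBound μ q Q C)
    (hlam : 0 < lam) : krrObjective μ q Q lam β = (1 / 2) * ∫ z, z.2 * z.2 ∂Q -
      1 / (2 * lam) * crossForm Q (pairKernel μ 0 q β) (fun z => z.2) r := by
  have h := hr.euler _ hC.memLp_response
  rw [hr.value]
  set A := ∫ z, z.2 * z.2 ∂Q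
  set B := ∫ z, z.2 * r z ∂Q
  have h2 : crossForm Q (pairKernel μ 0 q β) (fun z => z.2) r = lam * (A - B) := by linarith
  rw [h2]
  field_simp
  ring

/-- With zero weights the kernel is the constant `h(0)`, so the form is `h(0) E[Y] E[r]`, which
vanishes by centering. -/
theorem krrObjective_zero (hC : CommonBound μ q Q C) (hlam : 0 < lam)
    (hcent : ∫ z, z.2 ∂Q = 0) :
    krrObjective μ q Q lam 0 = (1 / 2) * ∫ z, z.2 * z.2 ∂Q := by
  obtain ⟨r, hr⟩ := exists_isResidual (q := q) (β := 0) hC.mass_bdd hC.memLp_response hlam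
    (fun _ => le_rfl)
  rw [hr.krrObjective_eq hC hlam]
  have h0 : crossForm Q (pairKernel μ 0 q (0 : Fin p → ℝ)) (fun z => z.2) r = 0 := by
    have e : ∀ w, pairKernel μ 0 q (0 : Fin p → ℝ) w = laplaceMoment μ 0 0 := fun w => by
      simp [pairKernel, weightedGap]
    simp only [crossForm, e]
    rw [integral_mul_const]
    have := integral_prod_mul (L := ℝ) (μ := Q) (ν := Q) (fun z => z.2) r
    rw [this, hcent, zero_mul, zero_mul]
  rw [h0, mul_zero, sub_zero]

/-- A gain over the zero weights forces the residual to keep kernel energy. -/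
theorem IsResidual.crossForm_self_lower_bound (hr : IsResidual μ q Q lam β r)
    (hC : CommonBound μ q Q C) (hlam : 0 < lam) (hβ : ∀ i, 0 ≤ β i)
    (hcent : ∫ z, z.2 ∂Q = 0) {c : ℝ} (hc : 0 ≤ c)
    (hgain : c ≤ krrObjective μ q Q lam 0 - krrObjective μ q Q lam β) :
    4 * lam ^ 2 * c ^ 2 / C ^ 3 ≤ crossForm Q (pairKernel μ 0 q β) r r := by
  have hC1 := hC.one_le
  have hY := hC.memLp_response
  have k := memLp_top_pairKernel hC.mass_bdd 0 q hβ (Q.prod Q)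
  rw [krrObjective_zero hC hlam hcent, hr.krrObjective_eq hC hlam] at hgain
  set b := crossForm Q (pairKernel μ 0 q β) (fun z => z.2) r with hb
  set a := crossForm Q (pairKernel μ 0 q β) r r with ha
  -- The gain over zero weights is exactly `b / (2 lam)`.
  have hb1 : 2 * lam * c ≤ b := by
    have h : c ≤ 1 / (2 * lam) * b := by linarith
    rw [one_div, ← div_eq_inv_mul, le_div_iff₀ (by positivity)] at h
    linarith
  have hyy : crossForm Q (pairKernel μ 0 q β) (fun z => z.2) (fun z => z.2) ≤ C ^ 3 := by
    refine (le_abs_self _).trans ((abs_crossForm_le (C := C) (.of_forall fun w => ?_)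
      hY hY).trans ?_)
    · rw [abs_of_nonneg (pairKernel_nonneg _ _ _ _ _)]
      exact (pairKernel_le hC.mass_bdd 0 q hβ w).trans (hC.moment 0 (by norm_num))
    · have h1 : ∫ z, |z.2| ∂Q ≤ C := by
        refine (integral_mono_ae hY.abs_top.integrable_top (integrable_const C)
          hC.response).trans_eq ?_
        simp
      have h0 : 0 ≤ ∫ z, |z.2| ∂Q := integral_nonneg fun z => abs_nonneg _
      calc _ ≤ C * (C * C) := by gcongr
        _ = _ := by ring
  -- Cauchy-Schwarz by hand: the form at `r - t Y` is nonnegative, and `t` is optimal once the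
  -- energy of `Y` is replaced by its bound `C^3`. This yields `a ≥ b² / C^3`.
  set t : ℝ := b / C ^ 3 with ht
  have hty : MemLp (fun z : (Fin p → ℝ) × ℝ => t * z.2) ⊤ Q := hY.const_mul t
  have hpos := crossForm_pairKernel_nonneg (q := q) hC.mass_bdd hβ (hr.memLp.sub hty)
  have e1 := crossForm_sub_left k hr.memLp hty (hr.memLp.sub hty)
  have e2 := crossForm_sub_right k hr.memLp hr.memLp hty
  have e3 := crossForm_sub_right k hty hr.memLp hty
  change 0 ≤ crossForm Q (pairKernel μ 0 q β) (fun z => r z - t * z.2) (fun z => r z - t * z.2)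
    at hpos
  change crossForm Q (pairKernel μ 0 q β) (fun z => r z - t * z.2) (fun z => r z - t * z.2) =
    crossForm Q (pairKernel μ 0 q β) r (fun z => r z - t * z.2) -
    crossForm Q (pairKernel μ 0 q β) (fun z => t * z.2) (fun z => r z - t * z.2) at e1
  rw [e1, e2, e3, crossForm_const_mul_left, crossForm_const_mul_left, crossForm_const_mul_right,
    crossForm_const_mul_right,
    crossForm_comm (pairKernel_swap μ 0 q β) r (fun z => z.2), ← ha, ← hb] at hpos
  have h1 : t * (t * crossForm Q (pairKernel μ 0 q β) (fun z => z.2) (fun z => z.2)) ≤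
      t * (t * C ^ 3) := by
    rw [← mul_assoc, ← mul_assoc]
    exact mul_le_mul_of_nonneg_left hyy (mul_self_nonneg t)
  have h2 : t * C ^ 3 = b := by
    rw [ht]
    field_simp
  rw [h2] at h1
  have h3 : t * b ≤ a := by linarith
  refine le_trans ?_ h3
  rw [ht, div_mul_eq_mul_div]
  refine div_le_div_of_nonneg_right ?_ (by positivity)
  calc 4 * lam ^ 2 * c ^ 2 = (2 * lam * c) * (2 * lam * c) := by ring
    _ ≤ b * b := mul_self_le_mul_self (by positivity) hb1

omit [Fact (q = 1 ∨ q = 2)] in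
/-- As `μ` lives on `[m, ∞)`, `-h' - m h` is again a Laplace transform of a positive measure. -/
theorem crossForm_moment_one_lower_bound (hq : q = 1 ∨ q = 2) (hC : CommonBound μ q Q C) {m : ℝ}
    (hm : ∀ᵐ t : ℝ≥0 ∂μ, m ≤ (t : ℝ)) (hβ : ∀ i, 0 ≤ β i) (hr : MemLp r ⊤ Q) :
    m * crossForm Q (pairKernel μ 0 q β) r r ≤ crossForm Q (pairKernel μ 1 q β) r r := by
  have : Fact (q = 1 ∨ q = 2) := ⟨hq⟩
  have hT := hC.mass_bdd
  have i1 := fun z => integrable_laplaceMoment hT 1 z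
  have i0 := fun z => integrable_laplaceMoment hT 0 z
  have hint : Integrable (fun t : ℝ≥0 => (t : ℝ) - m) μ := by
    have := i1 0
    simp only [pow_one, mul_zero, neg_zero, Real.exp_zero, mul_one] at this
    exact this.sub (integrable_const m)
  set ν : Measure ℝ≥0 := μ.withDensity fun t => ENNReal.ofReal ((t : ℝ) - m) with hν
  have : IsFiniteMeasure ν := isFiniteMeasure_withDensity_ofReal hint.2
  have hTν : ∀ᵐ t : ℝ≥0 ∂ν, (t : ℝ) ≤ C := (withDensity_absolutelyContinuous _ _).ae_le hT
  have key : ∀ z, laplaceMoment ν 0 z = laplaceMoment μ 1 z - m * laplaceMoment μ 0 z := by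
    intro z
    rw [laplaceMoment, hν, integral_withDensity_eq_integral_toReal_smul (by fun_prop)
      (.of_forall fun _ => ENNReal.ofReal_lt_top), laplaceMoment, laplaceMoment,
      ← integral_const_mul, ← integral_sub (i1 z) ((i0 z).const_mul m)]
    refine integral_congr_ae ?_
    filter_upwards [hm] with t ht
    rw [ENNReal.toReal_ofReal (by linarith), smul_eq_mul]
    ring
  have h := crossForm_pairKernel_nonneg (q := q) hTν hβ hr
  have k0 := memLp_top_pairKernel hT 0 q hβ (Q.prod Q)
  have k1 := memLp_top_pairKernel hT 1 q hβ (Q.prod Q)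
  have e := crossForm_kernel_sub (κ' := fun w => m * pairKernel μ 0 q β w) k1 (k0.const_mul m) hr hr
  have e2 : crossForm Q (fun w => m * pairKernel μ 0 q β w) r r =
      m * crossForm Q (pairKernel μ 0 q β) r r := by
    rw [crossForm, crossForm, ← integral_const_mul]
    exact integral_congr_ae (.of_forall fun w => by ring)
  have e3 : pairKernel ν 0 q β = fun w => pairKernel μ 1 q β w - m * pairKernel μ 0 q β w :=
    funext fun w => key _
  rw [e3, e, e2] at h
  linarith

end

/-! ### Decoupling of signal and noise features. -/

section Independence
variable {Q : Measure ((Fin p → ℝ) × ℝ)} [IsProbabilityMeasure Q] {S : Finset (Fin p)}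

theorem measurable_subvector (T : Finset (Fin p)) : Measurable (subvector T) := by
  unfold subvector
  fun_prop

/-- The `σ`-algebra of the features. -/
abbrev featureSigma (p : ℕ) : MeasurableSpace ((Fin p → ℝ) × ℝ) :=
  MeasurableSpace.comap (Prod.fst : (Fin p → ℝ) × ℝ → (Fin p → ℝ)) inferInstance

/-- The `σ`-algebra of a subvector of the features. -/
abbrev subvectorSigma (T : Finset (Fin p)) : MeasurableSpace ((Fin p → ℝ) × ℝ) :=
  MeasurableSpace.comap (subvector T) inferInstance

/-- Under sufficiency of `S`, functions of `X_{Sᶜ}` decouple from the response and `X_S`. -/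
theorem IsSufficient.integral_response_mul (hS : IsSufficient Q S)
    (hY : MemLp (fun z : (Fin p → ℝ) × ℝ => z.2) ⊤ Q)
    {a : (S → ℝ) → ℝ} {b : ((Sᶜ : Finset (Fin p)) → ℝ) → ℝ} (ha : Measurable a)
    (hb : Measurable b) (ha' : MemLp (fun z => a (subvector S z)) ⊤ Q)
    (hb' : MemLp (fun z => b (subvector Sᶜ z)) ⊤ Q) :
    ∫ z, z.2 * (a (subvector S z) * b (subvector Sᶜ z)) ∂Q =
      (∫ z, z.2 * a (subvector S z) ∂Q) * ∫ z, b (subvector Sᶜ z) ∂Q := by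
  have hm_le : featureSigma p ≤ Prod.instMeasurableSpace := measurable_fst.comap_le
  have hmS_le : subvectorSigma S ≤ Prod.instMeasurableSpace := (measurable_subvector S).comap_le
  have hsub : ∀ T : Finset (Fin p), Measurable[featureSigma p] (subvector T) := fun T => by
    have : Measurable fun x : Fin p → ℝ => fun i : T => x i := by fun_prop
    exact this.comp (comap_measurable _)
  have hYi : Integrable (Prod.snd : (Fin p → ℝ) × ℝ → ℝ) Q := hY.integrable_top
  set f : (Fin p → ℝ) × ℝ → ℝ := fun z => a (subvector S z) * b (subvector Sᶜ z)
  have hf : StronglyMeasurable[featureSigma p] f :=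
    ((ha.comp (hsub S)).mul (hb.comp (hsub Sᶜ))).stronglyMeasurable
  have hfL : MemLp f ⊤ Q := ha'.mul_top hb'
  -- Condition on all of `X`, then use sufficiency to replace `E[Y | X]` by `E[Y | X_S]`.
  have h1 : ∫ z, z.2 * f z ∂Q = ∫ z, f z * (Q[Prod.snd|subvectorSigma S]) z ∂Q := by
    rw [← integral_condExp hm_le]
    refine integral_congr_ae ?_
    have hmul := condExp_mul_of_stronglyMeasurable_left (μ := Q) (g := Prod.snd) hf
      (hfL.mul_top hY).integrable_top hYi
    have hcomm : (fun z : (Fin p → ℝ) × ℝ => z.2 * f z) = f * Prod.snd :=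
      funext fun z => mul_comm _ _
    rw [hcomm]
    filter_upwards [hmul, hS.1] with z hz hz'
    rw [hz, Pi.mul_apply, hz']
  have hgS : StronglyMeasurable[subvectorSigma S] (Q[Prod.snd|subvectorSigma S]) := stronglyMeasurable_condExp
  have haS : StronglyMeasurable[subvectorSigma S] fun z => a (subvector S z) :=
    (ha.comp (comap_measurable _)).stronglyMeasurable
  have hmulS := condExp_mul_of_stronglyMeasurable_left (μ := Q) (g := Prod.snd) haS
      (ha'.mul_top hY).integrable_top hYi
  have h2 : ∫ z, z.2 * a (subvector S z) ∂Q =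
      ∫ z, a (subvector S z) * (Q[Prod.snd|subvectorSigma S]) z ∂Q := by
    rw [← integral_condExp hmS_le]
    refine integral_congr_ae ?_
    have hcomm : (fun z : (Fin p → ℝ) × ℝ => z.2 * a (subvector S z)) =
      (fun z => a (subvector S z)) * Prod.snd := funext fun z => mul_comm _ _
    rw [hcomm]
    exact hmulS
  -- `E[Y | X_S]` is measurable with respect to `X_S`, so independence of `X_S` and `X_{Sᶜ}` applies
  -- to it.
  have hind : IndepFun (fun z => a (subvector S z) * (Q[Prod.snd|subvectorSigma S]) z)
      (fun z => b (subvector Sᶜ z)) Q := by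
    have h := hS.2
    rw [IndepFun_iff_Indep] at h ⊢
    refine indep_of_indep_of_le_left (indep_of_indep_of_le_right h ?_) ?_
    · exact (hb.comp (comap_measurable _)).comap_le
    · exact (haS.mul hgS).measurable.comap_le
  have h3 := hind.integral_fun_mul_eq_mul_integral
    ((haS.mono hmS_le).mul (hgS.mono hmS_le)).aestronglyMeasurable hb'.1
  rw [h1, h2, ← h3]
  exact integral_congr_ae (.of_forall fun z => by ring)

/-- `r` decouples from functions of `X_{Sᶜ}`, given functions of `X_S`. -/
def Decouples (Q : Measure ((Fin p → ℝ) × ℝ)) (S : Finset (Fin p))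
    (r : (Fin p → ℝ) × ℝ → ℝ) : Prop :=
  ∀ (a : (S → ℝ) → ℝ) (b : ((Sᶜ : Finset (Fin p)) → ℝ) → ℝ), Measurable a → Measurable b →
    MemLp (fun z => a (subvector S z)) ⊤ Q → MemLp (fun z => b (subvector Sᶜ z)) ⊤ Q →
    ∫ z, r z * (a (subvector S z) * b (subvector Sᶜ z)) ∂Q =
      (∫ z, r z * a (subvector S z) ∂Q) * ∫ z, b (subvector Sᶜ z) ∂Q

theorem IsSufficient.decouples_sub (hS : IsSufficient Q S)
    (hY : MemLp (fun z : (Fin p → ℝ) × ℝ => z.2) ⊤ Q) {g : (S → ℝ) → ℝ} (hg : Measurable g)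
    (hg' : MemLp (fun z => g (subvector S z)) ⊤ Q) :
    Decouples Q S fun z => z.2 - g (subvector S z) := by
  intro a b ha hb ha' hb'
  have h1 := hS.integral_response_mul hY ha hb ha' hb'
  have hind : IndepFun (fun z => g (subvector S z) * a (subvector S z))
      (fun z => b (subvector Sᶜ z)) Q := hS.2.comp (hg.mul ha) hb
  have h2 := hind.integral_fun_mul_eq_mul_integral (hg'.mul_top ha').1 hb'.1
  simp only [sub_mul]
  rw [integral_sub (hY.mul_top (ha'.mul_top hb')).integrable_top
    (hg'.mul_top (ha'.mul_top hb')).integrable_top,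
    integral_sub (hY.mul_top ha').integrable_top (hg'.mul_top ha').integrable_top, h1, sub_mul,
    ← h2]
  simp only [mul_assoc]

/-- Decoupling is used twice: in the inner integral with the first point frozen, then in the outer
one with the partial integrals `a` and `b` as test functions. -/
theorem Decouples.crossForm_mul {r : (Fin p → ℝ) × ℝ → ℝ} (hr : Decouples Q S r)
    (hrL : MemLp r ⊤ Q) {K : (S → ℝ) × (S → ℝ) → ℝ}
    {L : ((Sᶜ : Finset (Fin p)) → ℝ) × ((Sᶜ : Finset (Fin p)) → ℝ) → ℝ}
    (hK : Measurable K) (hL : Measurable L) {A B : ℝ} (hKA : ∀ w, |K w| ≤ A)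
    (hLB : ∀ᵐ w ∂(Q.prod Q), |L (subvector Sᶜ w.1, subvector Sᶜ w.2)| ≤ B) :
    crossForm Q (fun w => K (subvector S w.1, subvector S w.2) *
        L (subvector Sᶜ w.1, subvector Sᶜ w.2)) r r =
      crossForm Q (fun w => K (subvector S w.1, subvector S w.2)) r r *
        ∫ w, L (subvector Sᶜ w.1, subvector Sᶜ w.2) ∂(Q.prod Q) := by
  have mS := measurable_subvector S
  have mSc := measurable_subvector Sᶜ
  have hKL : MemLp (fun w : ((Fin p → ℝ) × ℝ) × ((Fin p → ℝ) × ℝ) =>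
      K (subvector S w.1, subvector S w.2)) ⊤ (Q.prod Q) :=
    memLp_top_of_bound (hK.comp (by fun_prop)).aestronglyMeasurable A
      (.of_forall fun w => hKA _)
  have hLL : MemLp (fun w : ((Fin p → ℝ) × ℝ) × ((Fin p → ℝ) × ℝ) =>
      L (subvector Sᶜ w.1, subvector Sᶜ w.2)) ⊤ (Q.prod Q) :=
    memLp_top_of_bound (hL.comp (by fun_prop)).aestronglyMeasurable B hLB
  have hae := Measure.ae_ae_of_ae_prod hLB
  set a : (S → ℝ) → ℝ := fun u => ∫ z, r z * K (u, subvector S z) ∂Q with ha_def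
  set b : ((Sᶜ : Finset (Fin p)) → ℝ) → ℝ := fun v => ∫ z, L (v, subvector Sᶜ z) ∂Q with hb_def
  -- A measurable version of `r` is needed to make the parameter integral `a` measurable.
  obtain ⟨r', hr'm, hr'⟩ := hrL.1
  have ha : Measurable a := by
    have e : a = fun u => ∫ z, r' z * K (u, subvector S z) ∂Q := funext fun u =>
      integral_congr_ae (hr'.mono fun z hz => by simp only [hz])
    rw [e]
    refine (StronglyMeasurable.integral_prod_right' (ν := Q)
      (f := fun w : (S → ℝ) × ((Fin p → ℝ) × ℝ) => r' w.2 * K (w.1, subvector S w.2)) ?_).measurable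
    have := hr'm.measurable
    exact ((this.comp measurable_snd).mul (hK.comp (by fun_prop))).stronglyMeasurable
  have hb : Measurable b :=
    (StronglyMeasurable.integral_prod_right' (ν := Q)
      (f := fun w : ((Sᶜ : Finset (Fin p)) → ℝ) × ((Fin p → ℝ) × ℝ) =>
        L (w.1, subvector Sᶜ w.2)) (hL.comp (by fun_prop)).stronglyMeasurable).measurable
  have ha' : MemLp (fun z => a (subvector S z)) ⊤ Q := by
    refine memLp_top_of_bound (ha.comp mS).aestronglyMeasurable ((∫ z, |r z| ∂Q) * A)
      (.of_forall fun z => ?_)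
    rw [← integral_mul_const]
    refine norm_integral_le_of_norm_le (hrL.abs_top.integrable_top.mul_const A)
      (.of_forall fun z' => ?_)
    rw [norm_mul]
    exact mul_le_mul_of_nonneg_left (hKA _) (abs_nonneg _)
  have hb' : MemLp (fun z => b (subvector Sᶜ z)) ⊤ Q := by
    refine memLp_top_of_bound (hb.comp mSc).aestronglyMeasurable B ?_
    filter_upwards [hae] with z hz
    refine (norm_integral_le_of_norm_le_const hz).trans_eq ?_
    simp
  rw [crossForm_eq_integral_integral (hKL.mul_top hLL) hrL hrL,
    crossForm_eq_integral_integral hKL hrL hrL, integral_prod _ hLL.integrable_top,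
    ← hr a b ha hb ha' hb']
  refine integral_congr_ae ?_
  filter_upwards [hae] with z hz
  congr 1
  exact hr (fun u => K (subvector S z, u)) (fun v => L (subvector Sᶜ z, v))
    (hK.comp (by fun_prop)) (hL.comp (by fun_prop))
    (memLp_top_of_bound (hK.comp (by fun_prop)).aestronglyMeasurable A (.of_forall fun _ => hKA _))
    (memLp_top_of_bound (hL.comp (by fun_prop)).aestronglyMeasurable B hz)

end Independence

section
variable {μ : Measure ℝ≥0} [IsFiniteMeasure μ] {q : ℕ} [hq : Fact (q = 1 ∨ q = 2)]
  {Q : Measure ((Fin p → ℝ) × ℝ)} [IsProbabilityMeasure Q] {C lam : ℝ} {β : Fin p → ℝ}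
  {r : (Fin p → ℝ) × ℝ → ℝ} {S : Finset (Fin p)}

theorem IsResidual.decouples (hr : IsResidual μ q Q lam β r) (hC : CommonBound μ q Q C)
    (hS : IsSufficient Q S) (hβS : ∀ j ∉ S, β j = 0) : Decouples Q S r := by
  have hq0 : q ≠ 0 := by rcases hq.out with rfl | rfl <;> norm_num
  obtain ⟨g, hg, ⟨D, hD⟩, hrg⟩ := hr.feature
  -- The values filled in off `S` do not matter, since there `β i ^ (1 / q) = 0`; this uses `1 / q ≠
  -- 0`, because `0 ^ 0 = 1`.
  let ext : (S → ℝ) → Fin p → ℝ := fun u i => if h : i ∈ S then u ⟨i, h⟩ else 0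
  have hext : Measurable ext := measurable_pi_iff.2 fun i => by
    by_cases h : i ∈ S
    · simp only [ext, h, dif_pos]
      fun_prop
    · simp only [ext, h, dif_neg, not_false_eq_true]
      fun_prop
  have e : ∀ x : (Fin p → ℝ) × ℝ, rescale q β x.1 = rescale q β (ext (subvector S x)) := by
    intro x
    funext i
    by_cases h : i ∈ S
    · simp [rescale, ext, h, subvector]
    · rw [rescale, rescale, hβS i h, Real.zero_rpow (by simpa using hq0), zero_mul, zero_mul]
  have hm : Measurable fun u : S → ℝ => g (rescale q β (ext u)) :=
    hg.comp ((measurable_rescale q β).comp hext)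
  have h := hS.decouples_sub hC.memLp_response hm
    (memLp_top_of_bound (hm.comp (measurable_subvector S)).aestronglyMeasurable D
      (.of_forall fun z => hD _))
  have : r = fun z => z.2 - g (rescale q β (ext (subvector S z))) := by
    funext z
    rw [hrg, e]
  rw [this]
  exact h

/-- Off the signal set, the gradient at weights carried by `S` factorizes. -/
theorem IsResidual.krrGradient_eq (hr : IsResidual μ q Q lam β r) (hC : CommonBound μ q Q C)
    (hβ : ∀ i, 0 ≤ β i) (hS : IsSufficient Q S) (hβS : ∀ j ∉ S, β j = 0) {j : Fin p}
    (hj : j ∉ S) : krrGradient μ q Q lam β r j = 1 / (2 * lam) *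
      (crossForm Q (pairKernel μ 1 q β) r r * ∫ w, coordGap q j w ∂(Q.prod Q)) := by
  have hjc : j ∈ Sᶜ := Finset.mem_compl.2 hj
  have hgap : ∀ w : ((Fin p → ℝ) × ℝ) × ((Fin p → ℝ) × ℝ), weightedGap q β w =
      ∑ i : S, β i * |subvector S w.1 i - subvector S w.2 i| ^ q := fun w => by
    rw [weightedGap, ← Finset.sum_subset (Finset.subset_univ S)
      (fun i _ hi => by rw [hβS i hi, zero_mul]), ← Finset.sum_coe_sort]
    rfl
  have h := (hr.decouples hC hS hβS).crossForm_mul hr.memLp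
    (K := fun u => laplaceMoment μ 1 (∑ i : S, β i * |u.1 i - u.2 i| ^ q))
    (L := fun v => |v.1 ⟨j, hjc⟩ - v.2 ⟨j, hjc⟩| ^ q) (A := C) (B := C)
    ((continuous_laplaceMoment hC.mass_bdd 1).measurable.comp (by fun_prop)) (by fun_prop)
    (fun u => by
      rw [abs_of_nonneg (laplaceMoment_nonneg _ _ _)]
      exact (laplaceMoment_le hC.mass_bdd 1 (Finset.sum_nonneg fun i _ =>
        mul_nonneg (hβ _) (pow_nonneg (abs_nonneg _) q))).trans (hC.moment 1 (by norm_num)))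
    (hC.coordGap_le.mono fun w hw => by
      rw [abs_of_nonneg (by positivity)]
      exact hw j)
  simp only [← hgap] at h
  rw [krrGradient]
  congr 1

end

/-- If the integral vanished, Fubini would give a single point `z` with `X_j = z_j` almost surely,
and the variance would be zero. -/
theorem integral_coordGap_pos {q : ℕ} (hq : q ≠ 0) {Q : Measure ((Fin p → ℝ) × ℝ)}
    [IsProbabilityMeasure Q] {j : Fin p} (hW : MemLp (coordGap q j) ⊤ (Q.prod Q))
    (hvar : 0 < variance (fun z : (Fin p → ℝ) × ℝ => z.1 j) Q) :
    0 < ∫ w, coordGap q j w ∂(Q.prod Q) := by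
  refine (integral_nonneg fun w => coordGap_nonneg q j w).lt_of_ne fun h => hvar.ne' ?_
  have h0 := (integral_eq_zero_iff_of_nonneg (fun w => coordGap_nonneg q j w)
    hW.integrable_top).1 h.symm
  obtain ⟨z, hz⟩ := (Measure.ae_ae_of_ae_prod h0).exists
  have h1 : (fun z : (Fin p → ℝ) × ℝ => z.1 j) =ᵐ[Q] fun _ => z.1 j := by
    filter_upwards [hz] with z' hz'
    have := pow_eq_zero_iff hq |>.1 (show |z.1 j - z'.1 j| ^ q = 0 from hz')
    have := abs_eq_zero.1 this
    linarith
  rw [variance_congr h1, variance_eq_integral measurable_const.aemeasurable]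
  simp

end SelfPen

/-! ### The feasible box, Lipschitz gradients and stationarity. -/

namespace SelfPen

variable {p : ℕ}

theorem feasibleSet_eq_pi (p : ℕ) (M : ℝ) :
    feasibleSet p M = Set.univ.pi fun _ : Fin p => Set.Icc 0 M := by
  ext β
  simp only [feasibleSet, Set.mem_ofPred_eq, Set.mem_univ_pi, Set.mem_Icc]
  constructor
  · exact fun h i => ⟨h.1 i, (le_abs_self _).trans (h.2 i)⟩
  · exact fun h => ⟨fun i => (h i).1, fun i => by rw [abs_of_nonneg (h i).1]; exact (h i).2⟩

theorem isCompact_feasibleSet (p : ℕ) (M : ℝ) : IsCompact (feasibleSet p M) := by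
  rw [feasibleSet_eq_pi]
  exact isCompact_univ_pi fun _ => isCompact_Icc

theorem convex_feasibleSet (p : ℕ) (M : ℝ) : Convex ℝ (feasibleSet p M) := by
  rw [feasibleSet_eq_pi]
  exact convex_pi fun _ _ => convex_Icc _ _

theorem nonempty_interior_feasibleSet (p : ℕ) {M : ℝ} (hM : 0 < M) :
    (interior (feasibleSet p M)).Nonempty := by
  rw [feasibleSet_eq_pi, interior_pi_set Set.finite_univ]
  refine ⟨fun _ => M / 2, fun i _ => ?_⟩
  rw [interior_Icc]
  constructor <;> linarith

theorem uniqueDiffOn_feasibleSet (p : ℕ) {M : ℝ} (hM : 0 < M) :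
    UniqueDiffOn ℝ (feasibleSet p M) :=
  uniqueDiffOn_convex (convex_feasibleSet p M) (nonempty_interior_feasibleSet p hM)

theorem zero_mem_feasibleSet (p : ℕ) {M : ℝ} (hM : 0 < M) : (0 : Fin p → ℝ) ∈ feasibleSet p M :=
  ⟨fun _ => le_rfl, fun _ => by simpa using hM.le⟩

theorem sum_abs_sub_le (β γ : Fin p → ℝ) : ∑ i, |γ i - β i| ≤ p * ‖γ - β‖ := by
  refine (Finset.sum_le_card_nsmul _ _ ‖γ - β‖ fun i _ => norm_le_pi_norm (γ - β) i).trans_eq ?_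
  simp

/-- The linear functional with gradient `g`. -/
noncomputable def gradientFunctional (g : Fin p → ℝ) : (Fin p → ℝ) →L[ℝ] ℝ :=
  ∑ j, g j • ContinuousLinearMap.proj j

theorem gradientFunctional_apply (g η : Fin p → ℝ) :
    gradientFunctional g η = ∑ j, η j * g j := by
  simp [gradientFunctional, mul_comm]

theorem gradientFunctional_single (g : Fin p → ℝ) (j : Fin p) :
    gradientFunctional g (Pi.single j 1) = g j := by
  simp [gradientFunctional_apply, Pi.single_apply]

/-- `G` is a Lipschitz gradient of `F` on `D`, with a quadratic remainder. -/
structure HasLipschitzGradient (D : Set (Fin p → ℝ)) (F : (Fin p → ℝ) → ℝ)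
    (G : (Fin p → ℝ) → Fin p → ℝ) (L K : ℝ) : Prop where
  lipschitz : ∀ β ∈ D, ∀ γ ∈ D, |F γ - F β| ≤ L * ∑ i, |γ i - β i|
  taylor : ∀ β ∈ D, ∀ γ ∈ D,
    |F γ - F β - ∑ j, (γ j - β j) * G β j| ≤ K * (∑ i, |γ i - β i|) ^ 2
  gradient : ∀ β ∈ D, ∀ γ ∈ D, ∀ j, |G γ j - G β j| ≤ 2 * K * ∑ i, |γ i - β i|

section
variable {D : Set (Fin p → ℝ)} {F : (Fin p → ℝ) → ℝ} {G : (Fin p → ℝ) → Fin p → ℝ} {L K : ℝ}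

theorem HasLipschitzGradient.hasFDerivWithinAt (h : HasLipschitzGradient D F G L K)
    {β : Fin p → ℝ} (hβ : β ∈ D) : HasFDerivWithinAt F (gradientFunctional (G β)) D β := by
  rw [hasFDerivWithinAt_iff_isLittleO]
  have h1 : (fun γ => F γ - F β - gradientFunctional (G β) (γ - β)) =O[𝓝[D] β]
      fun γ => ‖γ - β‖ ^ 2 := by
    refine Asymptotics.IsBigO.of_bound (|K| * (p : ℝ) ^ 2) ?_
    filter_upwards [self_mem_nhdsWithin] with γ hγ
    rw [gradientFunctional_apply]
    refine (h.taylor β hβ γ hγ).trans ?_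
    rw [Real.norm_of_nonneg (by positivity), mul_assoc, ← mul_pow]
    refine mul_le_mul (le_abs_self K) ?_ (sq_nonneg _) (abs_nonneg _)
    exact pow_le_pow_left₀ (Finset.sum_nonneg fun i _ => abs_nonneg _) (sum_abs_sub_le β γ) 2
  refine h1.trans_isLittleO ?_
  have h2 : (fun x : Fin p → ℝ => ‖x‖ ^ 2) =o[𝓝 0] fun x => x :=
    Asymptotics.isLittleO_norm_pow_id one_lt_two
  refine (h2.comp_tendsto ?_).mono nhdsWithin_le_nhds
  have : Continuous fun γ : Fin p → ℝ => γ - β := by fun_prop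
  simpa using this.tendsto β

theorem HasLipschitzGradient.continuousOn (h : HasLipschitzGradient D F G L K) :
    ContinuousOn F D := fun _ hβ => (h.hasFDerivWithinAt hβ).continuousWithinAt

theorem HasLipschitzGradient.partialDeriv_eq (h : HasLipschitzGradient D F G L K)
    (hD : UniqueDiffOn ℝ D) {β : Fin p → ℝ} (hβ : β ∈ D) : partialDeriv F D β = G β := by
  funext j
  rw [partialDeriv, (h.hasFDerivWithinAt hβ).fderivWithin (hD β hβ), gradientFunctional_single]

theorem HasLipschitzGradient.locallyLipschitzOn (h : HasLipschitzGradient D F G L K) :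
    LocallyLipschitzOn D F := by
  have : LipschitzOnWith (|L| * p).toNNReal F D := by
    refine LipschitzOnWith.of_dist_le_mul fun γ hγ β hβ => ?_
    rw [Real.coe_toNNReal _ (by positivity), dist_eq_norm, dist_eq_norm, Real.norm_eq_abs,
      mul_assoc]
    refine (h.lipschitz β hβ γ hγ).trans ?_
    exact mul_le_mul (le_abs_self L) (sum_abs_sub_le β γ)
      (Finset.sum_nonneg fun i _ => abs_nonneg _) (abs_nonneg _)
  exact fun _ _ => ⟨_, D, self_mem_nhdsWithin, this⟩

/-- `G` is continuous up to the boundary, so it is the limit of the gradients at interior points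
approaching `β`. -/
theorem HasLipschitzGradient.mem_clarkeSubdifferential (h : HasLipschitzGradient D F G L K)
    (hD : UniqueDiffOn ℝ D) {β : Fin p → ℝ} (hβ : β ∈ D) (hcl : β ∈ closure (interior D)) :
    G β ∈ clarkeSubdifferential F D β := by
  obtain ⟨b, hb, hlim⟩ := mem_closure_iff_seq_limit.1 hcl
  have hbD : ∀ k, b k ∈ D := fun k => interior_subset (hb k)
  refine subset_convexHull ℝ _ ⟨b, fun k => ⟨hb k, ?_⟩, hlim, ?_⟩
  · exact ((h.hasFDerivWithinAt (hbD k)).hasFDerivAt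
      (mem_interior_iff_mem_nhds.1 (hb k))).differentiableAt
  · have e : (fun k => partialDeriv F D (b k)) = fun k => G (b k) :=
      funext fun k => h.partialDeriv_eq hD (hbD k)
    rw [e, tendsto_pi_nhds]
    intro j
    rw [tendsto_iff_norm_sub_tendsto_zero]
    have hlim' : Tendsto (fun k => 2 * K * ∑ i, |b k i - β i|) atTop (𝓝 0) := by
      have hc : Continuous fun x : Fin p → ℝ => 2 * K * ∑ i, |x i - β i| := by fun_prop
      simpa [Function.comp_def] using (hc.tendsto β).comp hlim
    exact squeeze_zero (fun k => norm_nonneg _) (fun k => h.gradient β hβ (b k) (hbD k) j) hlim'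

/-- First-order optimality on the face carried by `S` handles the coordinates in `S`. Off `S`, `β`
sits at its lower bound `0`, where a nonnegative derivative is compatible with the normal cone. -/
theorem HasLipschitzGradient.mem_stationaryPoints {M : ℝ} (hM : 0 < M)
    (h : HasLipschitzGradient (feasibleSet p M) F G L K) {S : Finset (Fin p)} {β : Fin p → ℝ}
    (hβ : β ∈ feasibleSet p M) (hβS : ∀ j ∉ S, β j = 0)
    (hmin : IsMinOn F {γ ∈ feasibleSet p M | ∀ j ∉ S, γ j = 0} β)
    (hpos : ∀ j ∉ S, 0 ≤ G β j) : β ∈ stationaryPoints F (feasibleSet p M) := by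
  have hconv := convex_feasibleSet p M
  have hcl : β ∈ closure (interior (feasibleSet p M)) := by
    rw [hconv.closure_interior_eq_closure_of_nonempty_interior (nonempty_interior_feasibleSet p hM)]
    exact subset_closure hβ
  refine ⟨hβ, G β, h.mem_clarkeSubdifferential (uniqueDiffOn_feasibleSet p hM) hβ hcl, -G β, ?_,
    add_neg_cancel _⟩
  intro γ hγ
  set D' : Set (Fin p → ℝ) := {γ ∈ feasibleSet p M | ∀ j ∉ S, γ j = 0} with hD'
  have hD'conv : Convex ℝ D' := by
    refine hconv.inter fun x hx y hy a b _ _ _ j hj => ?_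
    simp [hx j hj, hy j hj]
  -- The competitor `γ` with its coordinates off `S` deleted lies in the face; each deleted
  -- coordinate contributes `γ_j G_j ≥ 0` to the directional derivative.
  set γ' : Fin p → ℝ := fun i => if i ∈ S then γ i else 0 with hγ'
  have hγ'D : γ' ∈ D' := by
    refine ⟨⟨fun i => ?_, fun i => ?_⟩, fun j hj => by simp [hγ', hj]⟩
    · by_cases hi : i ∈ S <;> simp [hγ', hi, hγ.1 i]
    · by_cases hi : i ∈ S
      · simpa [hγ', hi] using hγ.2 i
      · simpa [hγ', hi] using hM.le
  have hβD' : β ∈ D' := ⟨hβ, hβS⟩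
  have hvar := hmin.localize.hasFDerivWithinAt_nonneg
    ((h.hasFDerivWithinAt hβ).mono fun x hx => hx.1)
    (sub_mem_posTangentConeAt_of_segment_subset (hD'conv.segment_subset hβD' hγ'D))
  rw [gradientFunctional_apply] at hvar
  have hle : ∑ j, (γ' - β) j * G β j ≤ ∑ j, (γ j - β j) * G β j := by
    refine Finset.sum_le_sum fun j _ => ?_
    by_cases hj : j ∈ S
    · simp [hγ', hj]
    · have := mul_nonneg (hγ.1 j) (hpos j hj)
      simpa [hγ', hj, hβS j hj] using this
  have : ∑ i, (-G β) i * (γ i - β i) = - ∑ j, (γ j - β j) * G β j := by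
    rw [← Finset.sum_neg_distrib]
    exact Finset.sum_congr rfl fun i _ => by simp; ring
  linarith

end

/-- The level sets are relatively open. -/
theorem exists_isOpen_levelSet_eq {S : Finset (Fin p)} {D : Set (Fin p → ℝ)}
    {F : (Fin p → ℝ) → ℝ} (hF : ContinuousOn F D) (c δ lam : ℝ) :
    ∃ U : Set (Fin p → ℝ), IsOpen U ∧ levelSet S D F c δ lam = U ∩ D := by
  obtain ⟨U, hU, hUD⟩ := continuousOn_iff'.1 hF (Set.Iio (F 0 - c)) isOpen_Iio
  have hV : IsOpen {β : Fin p → ℝ | ∑ j ∈ Sᶜ, |β j| < δ * c ^ 2 * lam ^ 3} :=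
    isOpen_lt (by fun_prop) continuous_const
  refine ⟨_, hU.inter hV, ?_⟩
  ext β
  have h := Set.ext_iff.1 hUD β
  simp only [Set.mem_inter_iff, Set.mem_preimage, Set.mem_Iio] at h
  simp only [levelSet, Set.mem_ofPred_eq, Set.mem_inter_iff]
  constructor
  · rintro ⟨hD, h1, h2⟩
    exact ⟨⟨(h.1 ⟨by linarith, hD⟩).1, h2⟩, hD⟩
  · rintro ⟨⟨h1, h2⟩, hD⟩
    exact ⟨hD, by linarith [(h.2 ⟨h1, hD⟩).1], h2⟩

/-- Points with positive coordinates are dense in relatively open sets. -/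
theorem subset_closure_pos {M : ℝ} (hM : 0 < M) {U : Set (Fin p → ℝ)} (hU : IsOpen U)
    {S : Finset (Fin p)} : U ∩ feasibleSet p M ⊆
      closure {β ∈ U ∩ feasibleSet p M | ∀ j ∉ S, 0 < β j} := by
  rintro β ⟨hβU, hβ⟩
  have hcl : β ∈ closure (interior (feasibleSet p M)) := by
    rw [(convex_feasibleSet p M).closure_interior_eq_closure_of_nonempty_interior
      (nonempty_interior_feasibleSet p hM)]
    exact subset_closure hβ
  have h := hU.inter_closure ⟨hβU, hcl⟩
  refine closure_mono ?_ h
  rintro γ ⟨hγU, hγ⟩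
  refine ⟨⟨hγU, interior_subset hγ⟩, fun j _ => ?_⟩
  rw [feasibleSet_eq_pi, interior_pi_set Set.finite_univ] at hγ
  have := hγ j trivial
  rw [interior_Icc] at this
  exact this.1

/-! ### Self-penalization of the level sets. -/

section
variable {μ : Measure ℝ≥0} [IsFiniteMeasure μ] {q : ℕ} [hq : Fact (q = 1 ∨ q = 2)]
  {Q : Measure ((Fin p → ℝ) × ℝ)} [IsProbabilityMeasure Q] {C lam : ℝ}

theorem hasLipschitzGradient_krrObjective (hC : CommonBound μ q Q C) (hlam : 0 < lam)
    (hlam1 : lam ≤ 1) {D : Set (Fin p → ℝ)} (hD : ∀ β ∈ D, ∀ i, 0 ≤ β i)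
    {r : (Fin p → ℝ) → (Fin p → ℝ) × ℝ → ℝ}
    (hr : ∀ β ∈ D, IsResidual μ q Q lam β (r β)) :
    HasLipschitzGradient D (krrObjective μ q Q lam) (fun β => krrGradient μ q Q lam β (r β))
      (C ^ 4 / lam) (C ^ 6 / lam ^ 2) where
  lipschitz β hβ γ hγ :=
    (hr β hβ).abs_krrObjective_sub_le (hr γ hγ) hC hlam (hD β hβ) (hD γ hγ)
  taylor β hβ γ hγ :=
    (hr β hβ).abs_krrObjective_taylor_le (hr γ hγ) hC hlam hlam1 (hD β hβ) (hD γ hγ)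
  gradient β hβ γ hγ j := by
    have := (hr β hβ).abs_krrGradient_sub_le (hr γ hγ) hC hlam hlam1 (hD β hβ) (hD γ hγ) j
    rwa [mul_div_assoc] at this

/-- Off the signal set, the gradient at weights carried by `S` is nonnegative, and bounded below
in terms of the gain over the zero weights. -/
theorem IsResidual.krrGradient_lower_bound {r : (Fin p → ℝ) × ℝ → ℝ} {β : Fin p → ℝ}
    {S : Finset (Fin p)} (hr : IsResidual μ q Q lam β r) (hC : CommonBound μ q Q C)
    (hlam : 0 < lam) (hβ : ∀ i, 0 ≤ β i) (hcent : ∫ z, z.2 ∂Q = 0) (hS : IsSufficient Q S)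
    (hβS : ∀ j ∉ S, β j = 0) {m v : ℝ} (hm0 : 0 < m) (hm : ∀ᵐ t : ℝ≥0 ∂μ, m ≤ (t : ℝ))
    (hv0 : 0 < v) (hv : ∀ j, v ≤ ∫ w, coordGap q j w ∂(Q.prod Q)) {c : ℝ} (hc : 0 ≤ c)
    (hgain : c ≤ krrObjective μ q Q lam 0 - krrObjective μ q Q lam β) {j : Fin p} (hj : j ∉ S) :
    2 * m * v / C ^ 3 * (lam * c ^ 2) ≤ krrGradient μ q Q lam β r j := by
  have hC1 := hC.one_le
  have h1 := hr.crossForm_self_lower_bound hC hlam hβ hcent hc hgain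
  have h2 := crossForm_moment_one_lower_bound hq.out hC hm hβ hr.memLp
  rw [hr.krrGradient_eq hC hβ hS hβS hj]
  calc 2 * m * v / C ^ 3 * (lam * c ^ 2) =
        1 / (2 * lam) * (m * (4 * lam ^ 2 * c ^ 2 / C ^ 3) * v) := by field_simp; ring
    _ ≤ _ := by
        have h3 : m * (4 * lam ^ 2 * c ^ 2 / C ^ 3) ≤ crossForm Q (pairKernel μ 1 q β) r r :=
          (mul_le_mul_of_nonneg_left h1 hm0.le).trans h2
        have h4 : 0 ≤ m * (4 * lam ^ 2 * c ^ 2 / C ^ 3) := by positivity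
        exact mul_le_mul_of_nonneg_left (mul_le_mul h3 (hv j) hv0.le (h4.trans h3)) (by positivity)

theorem IsResidual.krrGradient_nonneg {r : (Fin p → ℝ) × ℝ → ℝ} {β : Fin p → ℝ}
    {S : Finset (Fin p)} (hr : IsResidual μ q Q lam β r) (hC : CommonBound μ q Q C)
    (hlam : 0 < lam) (hβ : ∀ i, 0 ≤ β i) (hS : IsSufficient Q S)
    (hβS : ∀ j ∉ S, β j = 0) {m : ℝ} (hm0 : 0 < m) (hm : ∀ᵐ t : ℝ≥0 ∂μ, m ≤ (t : ℝ))
    {j : Fin p} (hj : j ∉ S) : 0 ≤ krrGradient μ q Q lam β r j := by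
  have h2 := crossForm_moment_one_lower_bound hq.out hC hm hβ hr.memLp
  have h3 := crossForm_pairKernel_nonneg (q := q) hC.mass_bdd hβ hr.memLp
  rw [hr.krrGradient_eq hC hβ hS hβS hj]
  exact mul_nonneg (by positivity) (mul_nonneg ((mul_nonneg hm0.le h3).trans h2)
    (integral_nonneg fun w => coordGap_nonneg q j w))

theorem krrObjective_zero_le (hC : CommonBound μ q Q C) (hlam : 0 < lam)
    (hcent : ∫ z, z.2 ∂Q = 0) : krrObjective μ q Q lam 0 ≤ C ^ 2 := by
  have hC1 := hC.one_le
  rw [krrObjective_zero hC hlam hcent]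
  have h1 : ∫ z, z.2 * z.2 ∂Q ≤ C ^ 2 := by
    refine (integral_mono_ae (hC.memLp_response.mul_top hC.memLp_response).integrable_top
      (integrable_const (C ^ 2)) ?_).trans_eq (by simp)
    filter_upwards [hC.response] with z hz
    have := sq_le_sq' (abs_le.1 hz).1 (abs_le.1 hz).2
    linarith
  have : 0 ≤ C ^ 2 := by positivity
  linarith

/-- The two smallness conditions on `δ` play different roles: the first lets the projection onto `S`
keep half of the gain, the second makes the variation of the gradient between a point and its
projection at most half of the lower bound at the projection. -/
theorem selfPenalizing_levelSet {M : ℝ} (hM : 0 < M) {S : Finset (Fin p)}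
    (hC : CommonBound μ q Q C) (hcent : ∫ z, z.2 ∂Q = 0) (hS : IsSufficient Q S)
    {m v : ℝ} (hm0 : 0 < m) (hm : ∀ᵐ t : ℝ≥0 ∂μ, m ≤ (t : ℝ))
    (hv0 : 0 < v) (hv : ∀ j, v ≤ ∫ w, coordGap q j w ∂(Q.prod Q)) {c δ : ℝ} (hc : 0 < c)
    (hδ : 0 < δ) (hlam : 0 < lam) (hlam1 : lam ≤ 1) (hδ1 : C ^ 6 * δ ≤ 1 / 2)
    (hδ2 : 8 * C ^ 9 * δ ≤ m * v)
    (hne : (levelSet S (feasibleSet p M) (krrObjective μ q Q lam) c δ lam).Nonempty) :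
    SelfPenalizing S (feasibleSet p M) (krrObjective μ q Q lam)
      (levelSet S (feasibleSet p M) (krrObjective μ q Q lam) c δ lam) := by
  have hC1 := hC.one_le
  set F := krrObjective μ q Q lam with hF
  set D := feasibleSet p M with hD
  set B := levelSet S D F c δ lam with hB
  have hres : ∀ β : Fin p → ℝ, ∃ r, β ∈ D → IsResidual μ q Q lam β r := fun β => by
    by_cases hβ : β ∈ D
    · obtain ⟨r, hr⟩ := exists_isResidual (q := q) hC.mass_bdd hC.memLp_response hlam hβ.1
      exact ⟨r, fun _ => hr⟩
    · exact ⟨0, fun h => (hβ h).elim⟩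
  choose r hr using hres
  set G : (Fin p → ℝ) → Fin p → ℝ := fun β => krrGradient μ q Q lam β (r β) with hG
  have hgrad : HasLipschitzGradient D F G (C ^ 4 / lam) (C ^ 6 / lam ^ 2) :=
    hasLipschitzGradient_krrObjective hC hlam hlam1 (fun β hβ => hβ.1) hr
  obtain ⟨U, hU, hBU⟩ := exists_isOpen_levelSet_eq (S := S) hgrad.continuousOn c δ lam
  -- Chosen so that the gradient bound at a gain of `c / 2` is `2 θ lam c²`; one `θ` is then spent
  -- on perturbations.
  set θ : ℝ := m * v / (4 * C ^ 3) with hθ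
  have hθ0 : 0 < θ := by positivity
  have hθδ : 2 * C ^ 6 * δ ≤ θ := by
    rw [hθ, le_div_iff₀ (by positivity)]
    calc 2 * C ^ 6 * δ * (4 * C ^ 3) = 8 * C ^ 9 * δ := by ring
      _ ≤ _ := hδ2
  let proj : (Fin p → ℝ) → Fin p → ℝ := fun β i => if i ∈ S then β i else 0
  have hproj : ∀ β ∈ D, proj β ∈ D := fun β hβ => by
    refine ⟨fun i => ?_, fun i => ?_⟩
    · by_cases hi : i ∈ S <;> simp [proj, hi, hβ.1 i]
    · by_cases hi : i ∈ S
      · simpa [proj, hi] using hβ.2 i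
      · simpa [proj, hi] using hM.le
  have hprojS : ∀ β, ∀ j ∉ S, proj β j = 0 := fun β j hj => by simp [proj, hj]
  have hσ : ∀ β, ∑ i, |β i - proj β i| = ∑ j ∈ Sᶜ, |β j| := fun β => by
    rw [← Finset.sum_add_sum_compl S, Finset.sum_eq_zero, zero_add]
    · exact Finset.sum_congr rfl fun j hj => by
        simp [proj, Finset.mem_compl.1 hj]
    · exact fun j hj => by simp [proj, hj]
  have hbase : ∀ β ∈ B, ∀ j ∉ S, 2 * θ * (lam * c ^ 2) ≤ G (proj β) j := fun β hβ j hj => by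
    have hβD := hβ.1
    have h1 := hgrad.lipschitz (proj β) (hproj β hβD) β hβD
    rw [hσ] at h1
    -- The gain never exceeds `F 0`; this absorbs the surplus factor `c` in the estimate of the loss
    -- under projection.
    have h2 : c ≤ C ^ 2 := by
      have h3 := krrObjective_zero_le (q := q) hC hlam hcent
      have h4 : 0 ≤ F β := krrObjective_nonneg Q hlam β
      have h5 : F 0 - F β > c := hβ.2.1
      linarith
    have h6 : C ^ 4 / lam * ∑ j ∈ Sᶜ, |β j| ≤ c / 2 := by
      calc C ^ 4 / lam * ∑ j ∈ Sᶜ, |β j| ≤ C ^ 4 / lam * (δ * c ^ 2 * lam ^ 3) :=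
            mul_le_mul_of_nonneg_left hβ.2.2.le (by positivity)
        _ = C ^ 4 * δ * c * c * lam ^ 2 := by field_simp
        _ ≤ C ^ 4 * δ * c * C ^ 2 * 1 := by
            gcongr
            exact pow_le_one₀ hlam.le hlam1
        _ = C ^ 6 * δ * c := by ring
        _ ≤ 1 / 2 * c := by gcongr
        _ = c / 2 := by ring
    have hgain : c / 2 ≤ F 0 - F (proj β) := by
      have := (abs_le.1 (h1.trans h6)).1
      have h5 : F 0 - F β > c := hβ.2.1
      linarith
    have h7 := (hr _ (hproj β hβD)).krrGradient_lower_bound hC hlam (hproj β hβD).1 hcent hS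
      (hprojS β) hm0 hm hv0 hv (by positivity) hgain hj
    refine le_trans (le_of_eq ?_) h7
    rw [hθ]
    field_simp
    ring
  have hbound : ∀ β ∈ B, ∀ j ∉ S, θ * (lam * c ^ 2) ≤ G β j := fun β hβ j hj => by
    have h1 := hgrad.gradient (proj β) (hproj β hβ.1) β hβ.1 j
    rw [hσ] at h1
    -- The power `lam ^ 3` in the level set comes from here: `lam ^ 2` compensates the Lipschitz
    -- constant of the gradient, and the remaining `lam` matches the lower bound.
    have h2 : 2 * (C ^ 6 / lam ^ 2) * ∑ j ∈ Sᶜ, |β j| ≤ θ * (lam * c ^ 2) := by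
      calc 2 * (C ^ 6 / lam ^ 2) * ∑ j ∈ Sᶜ, |β j| ≤
            2 * (C ^ 6 / lam ^ 2) * (δ * c ^ 2 * lam ^ 3) :=
            mul_le_mul_of_nonneg_left hβ.2.2.le (by positivity)
        _ = 2 * C ^ 6 * δ * (lam * c ^ 2) := by field_simp
        _ ≤ _ := by gcongr
    have h3 := (abs_le.1 (h1.trans h2)).1
    have h4 := hbase β hβ j hj
    linarith
  -- Expanding at the projection, the first-order term is at least `2 θ lam c²` times the deleted
  -- mass and dominates the quadratic remainder.
  have hdecr : ∀ β ∈ B, F (proj β) ≤ F β := fun β hβ => by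
    have h1 := hgrad.taylor (proj β) (hproj β hβ.1) β hβ.1
    rw [hσ] at h1
    have h2 : 2 * θ * (lam * c ^ 2) * ∑ j ∈ Sᶜ, |β j| ≤
        ∑ j, (β j - proj β j) * G (proj β) j := by
      rw [← Finset.sum_add_sum_compl S,
        Finset.sum_eq_zero (s := S) (fun j hj => by simp [proj, hj]), zero_add, Finset.mul_sum]
      refine Finset.sum_le_sum fun j hj => ?_
      have hj' := Finset.mem_compl.1 hj
      rw [hprojS β j hj', sub_zero, abs_of_nonneg (hβ.1.1 j), mul_comm]
      exact mul_le_mul_of_nonneg_left (hbase β hβ j hj') (hβ.1.1 j)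
    have h0 : 0 ≤ ∑ j ∈ Sᶜ, |β j| := Finset.sum_nonneg fun i _ => abs_nonneg _
    have h3 : C ^ 6 / lam ^ 2 * (∑ j ∈ Sᶜ, |β j|) ^ 2 ≤
        θ * (lam * c ^ 2) * ∑ j ∈ Sᶜ, |β j| := by
      rw [sq (∑ j ∈ Sᶜ, |β j|), ← mul_assoc]
      refine mul_le_mul_of_nonneg_right ?_ h0
      calc C ^ 6 / lam ^ 2 * ∑ j ∈ Sᶜ, |β j| ≤ C ^ 6 / lam ^ 2 * (δ * c ^ 2 * lam ^ 3) :=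
            mul_le_mul_of_nonneg_left hβ.2.2.le (by positivity)
        _ = C ^ 6 * δ * (lam * c ^ 2) := by field_simp
        _ ≤ 2 * C ^ 6 * δ * (lam * c ^ 2) := by
            have : 0 ≤ C ^ 6 * δ * (lam * c ^ 2) := by positivity
            linarith
        _ ≤ _ := by gcongr
    have h4 := (abs_le.1 (h1.trans h3)).1
    have h5 : 0 ≤ θ * (lam * c ^ 2) * ∑ j ∈ Sᶜ, |β j| := by positivity
    linarith
  -- Noise coordinates must be strictly positive in the dense subset, since `Real.sign 0 = 0` would
  -- destroy the lower bound.
  refine ⟨hgrad.locallyLipschitzOn, ⟨U, hU, hBU⟩,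
    ⟨{β ∈ B | ∀ j ∉ S, 0 < β j}, fun β hβ => hβ.1, ?_,
      fun β hβ => (hgrad.hasFDerivWithinAt hβ.1.1).differentiableWithinAt,
      θ * (lam * c ^ 2), by positivity, fun j hj β hβ => ?_⟩, ?_⟩
  · rw [hB, hBU]
    exact subset_closure_pos hM hU
  · rw [Real.sign_of_pos (hβ.2 j hj), one_mul,
      hgrad.partialDeriv_eq (uniqueDiffOn_feasibleSet p hM) hβ.1.1]
    exact hbound β hβ.1 j hj
  · obtain ⟨β, hβ⟩ := hne
    set D' : Set (Fin p → ℝ) := {γ ∈ D | ∀ j ∉ S, γ j = 0} with hD'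
    have hD'c : IsCompact D' := by
      have e : D' = D ∩ ⋂ j ∈ (Sᶜ : Finset (Fin p)), {γ : Fin p → ℝ | γ j = 0} := by
        ext γ
        simp [hD']
      rw [e]
      exact (isCompact_feasibleSet p M).inter_right (isClosed_biInter fun j _ =>
        isClosed_eq (continuous_apply j) continuous_const)
    obtain ⟨b, hb, hmin⟩ := hD'c.exists_isMinOn ⟨_, zero_mem_feasibleSet p hM, fun _ _ => rfl⟩
      (hgrad.continuousOn.mono fun x hx => hx.1)
    refine ⟨b, ⟨hb.1, ?_, ?_⟩, hgrad.mem_stationaryPoints hM hb.1 hb.2 hmin fun j hj =>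
      (hr b hb.1).krrGradient_nonneg hC hlam hb.1.1 hS hb.2 hm0 hm hj, fun j hj => ?_⟩
    · have h1 : F b ≤ F (proj β) := hmin ⟨hproj β hβ.1, hprojS β⟩
      have h2 := hdecr β hβ
      have h3 : F 0 - F β > c := hβ.2.1
      linarith
    · rw [Finset.sum_eq_zero fun j hj => by rw [hb.2 j (Finset.mem_compl.1 hj), abs_zero]]
      positivity
    · by_contra hjS
      exact hj (hb.2 j hjS)

end

end SelfPen

/-! ### From vanishing moments to vanishing conditional expectation. -/

namespace SelfPen

section Determining
variable {Ω : Type*} [MeasurableSpace Ω] {Q : Measure Ω} [IsProbabilityMeasure Q]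
  {ι : Type*} [Fintype ι] {Y : Ω → ℝ} {X : Ω → ι → ℝ}

omit [IsProbabilityMeasure Q] [Fintype ι] in
theorem memLp_top_list_prod (hX : Measurable X) {R : ℝ} (hR : ∀ᵐ z ∂Q, ∀ i, |X z i| ≤ R)
    (l : List ι) : MemLp (fun z => (l.map (X z)).prod) ⊤ Q := by
  induction l with
  | nil => simpa using memLp_top_const (1 : ℝ)
  | cons i l ih =>
    have hi : MemLp (fun z => X z i) ⊤ Q :=
      memLp_top_of_bound (by fun_prop) R (hR.mono fun z hz => hz i)
    simpa using hi.mul_top ih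

omit [Fintype ι] in
/-- Vanishing moments against `Y` extend to polynomials. -/
theorem integral_mul_polynomial_eq_zero (hY : MemLp Y ⊤ Q) (hX : Measurable X) {R : ℝ}
    (hR : ∀ᵐ z ∂Q, ∀ i, |X z i| ≤ R)
    (h : ∀ l : List ι, ∫ z, Y z * (l.map (X z)).prod ∂Q = 0) (P : MvPolynomial ι ℝ) :
    MemLp (fun z => MvPolynomial.eval (X z) P) ⊤ Q ∧
      ∀ l : List ι, ∫ z, Y z * (l.map (X z)).prod * MvPolynomial.eval (X z) P ∂Q = 0 := by
  induction P using MvPolynomial.induction_on with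
  | C a =>
    simp only [MvPolynomial.eval_C]
    refine ⟨memLp_top_const a, fun l => ?_⟩
    rw [integral_mul_const, h, zero_mul]
  | add P P' hP hP' =>
    simp only [map_add]
    refine ⟨hP.1.add hP'.1, fun l => ?_⟩
    have hl := hY.mul_top (memLp_top_list_prod hX hR l)
    simp only [mul_add]
    rw [integral_add (hl.mul_top hP.1).integrable_top (hl.mul_top hP'.1).integrable_top,
      hP.2, hP'.2, add_zero]
  | mul_X P i hP =>
    simp only [map_mul, MvPolynomial.eval_X]
    refine ⟨hP.1.mul_top (memLp_top_of_bound (by fun_prop) R (hR.mono fun z hz => hz i)),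
      fun l => ?_⟩
    -- The extra variable is absorbed into the list; the claim is quantified over lists for this
    -- purpose.
    rw [← hP.2 (i :: l)]
    refine integral_congr_ae (.of_forall fun z => ?_)
    simp only [List.map_cons, List.prod_cons]
    ring

/-- Vanishing moments against `Y` extend to continuous functions. -/
theorem integral_mul_continuous_eq_zero (hY : MemLp Y ⊤ Q) (hX : Measurable X) {R : ℝ}
    (hR : ∀ᵐ z ∂Q, ∀ i, |X z i| ≤ R)
    (h : ∀ l : List ι, ∫ z, Y z * (l.map (X z)).prod ∂Q = 0) {F : (ι → ℝ) → ℝ}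
    (hF : Continuous F) : ∫ z, Y z * F (X z) ∂Q = 0 := by
  have hpoly := integral_mul_polynomial_eq_zero hY hX hR h
  let coord : ι → C(ι → ℝ, ℝ) := fun i => ⟨fun u => u i, continuous_apply i⟩
  let Ψ : MvPolynomial ι ℝ →ₐ[ℝ] C(ι → ℝ, ℝ) := MvPolynomial.aeval coord
  have hΨ : ∀ P u, Ψ P u = MvPolynomial.eval u P := fun P u => by
    induction P using MvPolynomial.induction_on with
    | C a => simp [Ψ]
    | add P P' hP hP' => simp [hP, hP']
    | mul_X P i hP => simp [hP, Ψ, coord]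
  -- Stone-Weierstrass for the polynomials, on a compact cube that contains `X` almost surely.
  have hsep : Ψ.range.SeparatesPoints := by
    intro u v huv
    obtain ⟨i, hi⟩ := Function.ne_iff.1 huv
    exact ⟨coord i, ⟨coord i, ⟨MvPolynomial.X i, by simp [Ψ]⟩, rfl⟩, hi⟩
  have hK : IsCompact (Set.univ.pi fun _ : ι => Set.Icc (-R) R) :=
    isCompact_univ_pi fun _ => isCompact_Icc
  have hXK : ∀ᵐ z ∂Q, X z ∈ Set.univ.pi fun _ : ι => Set.Icc (-R) R :=
    hR.mono fun z hz i _ => abs_le.1 (hz i)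
  have hFX : MemLp (fun z => F (X z)) ⊤ Q := by
    obtain ⟨D, hD⟩ := hK.exists_bound_of_continuousOn hF.continuousOn
    exact memLp_top_of_bound (hF.measurable.comp hX).aestronglyMeasurable D
      (hXK.mono fun z hz => hD _ hz)
  set A := ∫ z, |Y z| ∂Q with hA
  have hA0 : 0 ≤ A := integral_nonneg fun z => abs_nonneg _
  have key : ∀ ε > 0, |∫ z, Y z * F (X z) ∂Q| ≤ A * ε := fun ε hε => by
    obtain ⟨g, ⟨P, rfl⟩, hg⟩ :=
      ContinuousMap.exists_mem_subalgebra_near_continuous_of_isCompact_of_separatesPoints hsep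
        ⟨F, hF⟩ hK hε
    have h1 : ∫ z, Y z * F (X z) ∂Q =
        ∫ z, Y z * (F (X z) - MvPolynomial.eval (X z) P) ∂Q := by
      have h2 := (hpoly P).2 []
      simp only [List.map_nil, List.prod_nil, mul_one] at h2
      simp only [mul_sub]
      rw [integral_sub (hY.mul_top hFX).integrable_top (hY.mul_top (hpoly P).1).integrable_top,
        h2, sub_zero]
    rw [h1, hA, ← integral_mul_const, ← Real.norm_eq_abs]
    refine norm_integral_le_of_norm_le (hY.abs_top.integrable_top.mul_const ε) ?_
    filter_upwards [hXK] with z hz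
    rw [norm_mul]
    refine mul_le_mul_of_nonneg_left ?_ (abs_nonneg _)
    have := (hg _ hz).le
    rw [norm_sub_rev]
    exact (hΨ P (X z)) ▸ this
  refine abs_nonpos_iff.1 (le_of_forall_pos_le_add fun ε hε => ?_)
  refine (key (ε / (A + 1)) (by positivity)).trans ?_
  rw [zero_add, mul_div_assoc', div_le_iff₀ (by positivity)]
  nlinarith

/-- If `Y` is orthogonal to all bounded continuous functions of `X`, it integrates to zero over
all events of `X`. -/
theorem setIntegral_eq_zero_of_forall_boundedContinuous (hY : MemLp Y ⊤ Q) (hYm : Measurable Y)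
    (hX : Measurable X) {C : ℝ} (hC : ∀ᵐ z ∂Q, |Y z| ≤ C)
    (h : ∀ F : BoundedContinuousFunction (ι → ℝ) ℝ, ∫ z, Y z * F (X z) ∂Q = 0)
    {A : Set (ι → ℝ)} (hA : MeasurableSet A) : ∫ z in X ⁻¹' A, Y z ∂Q = 0 := by
  have hint : Integrable (fun z => Y z + C) Q := hY.integrable_top.add (integrable_const C)
  have hC0 : 0 ≤ C := by
    obtain ⟨z, hz⟩ := hC.exists
    exact (abs_nonneg _).trans hz
  -- Adding `C` makes the density nonnegative, so the signed statement becomes equality of two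
  -- finite measures, the images of `(Y + C) Q` and `C Q` under `X`, tested on bounded continuous
  -- functions.
  set ρ₁ : Measure Ω := Q.withDensity fun z => ENNReal.ofReal (Y z + C)
  set ρ₂ : Measure Ω := Q.withDensity fun _ => ENNReal.ofReal C
  have : IsFiniteMeasure ρ₁ := isFiniteMeasure_withDensity_ofReal hint.2
  have : IsFiniteMeasure ρ₂ :=
    isFiniteMeasure_withDensity_ofReal (integrable_const (μ := Q) C).2
  have e₁ : ∀ F : (ι → ℝ) → ℝ, Measurable F → (∃ D, ∀ u, |F u| ≤ D) →
      ∫ u, F u ∂(ρ₁.map X) = ∫ z, Y z * F (X z) ∂Q + C * ∫ z, F (X z) ∂Q := by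
    rintro F hF ⟨D, hD⟩
    have hFX : MemLp (fun z => F (X z)) ⊤ Q :=
      memLp_top_of_bound (hF.comp hX).aestronglyMeasurable D (.of_forall fun z => hD _)
    rw [integral_map hX.aemeasurable hF.aestronglyMeasurable,
      integral_withDensity_eq_integral_toReal_smul (by fun_prop)
        (.of_forall fun _ => ENNReal.ofReal_lt_top), ← integral_const_mul,
      ← integral_add (hY.mul_top hFX).integrable_top (hFX.integrable_top.const_mul C)]
    refine integral_congr_ae ?_
    filter_upwards [hC] with z hz
    rw [ENNReal.toReal_ofReal (by linarith [(abs_le.1 hz).1]), smul_eq_mul]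
    ring
  have e₂ : ∀ F : (ι → ℝ) → ℝ, Measurable F →
      ∫ u, F u ∂(ρ₂.map X) = C * ∫ z, F (X z) ∂Q := by
    intro F hF
    rw [integral_map hX.aemeasurable hF.aestronglyMeasurable,
      integral_withDensity_eq_integral_toReal_smul (by fun_prop)
        (.of_forall fun _ => ENNReal.ofReal_lt_top), ← integral_const_mul]
    simp only [ENNReal.toReal_ofReal hC0, smul_eq_mul]
  have hmap : ρ₁.map X = ρ₂.map X := by
    refine ext_of_forall_integral_eq_of_IsFiniteMeasure fun F => ?_
    rw [e₁ F F.continuous.measurable ⟨‖F‖, fun u => F.norm_coe_le_norm u⟩,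
      e₂ F F.continuous.measurable, h, zero_add]
  have hm : Measurable (A.indicator fun _ => (1 : ℝ)) := measurable_const.indicator hA
  have h1 := e₁ _ hm ⟨1, fun u => by
    by_cases hu : u ∈ A <;> simp [hu]⟩
  rw [hmap, e₂ _ hm] at h1
  have h2 : ∫ z, Y z * A.indicator (fun _ => (1 : ℝ)) (X z) ∂Q = 0 := by linarith
  rw [← integral_indicator (hX hA), ← h2]
  refine integral_congr_ae (.of_forall fun z => ?_)
  by_cases hz : X z ∈ A <;> simp [Set.indicator, hz]

end Determining

/-! ### Differentiating kernel averages in the weights. -/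

section Moments
variable {Ω : Type*} [MeasurableSpace Ω] {Q : Measure Ω} [IsProbabilityMeasure Q]
  {μ : Measure ℝ≥0} [IsFiniteMeasure μ] {T : ℝ}

omit [IsProbabilityMeasure Q] in
theorem memLp_top_laplaceMoment (hT : ∀ᵐ t : ℝ≥0 ∂μ, (t : ℝ) ≤ T) (n : ℕ) {d : Ω → ℝ}
    (hd : Measurable d) (hd0 : ∀ z, 0 ≤ d z) : MemLp (fun z => laplaceMoment μ n (d z)) ⊤ Q :=
  memLp_top_of_bound ((continuous_laplaceMoment hT n).measurable.comp hd).aestronglyMeasurable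
    (laplaceMoment μ n 0) (.of_forall fun z => by
      rw [Real.norm_of_nonneg (laplaceMoment_nonneg _ _ _)]
      exact laplaceMoment_le hT n (hd0 z))

/-- Differentiation of a vanishing moment in one direction. -/
theorem integral_mul_laplaceMoment_succ_eq_zero (hT : ∀ᵐ t : ℝ≥0 ∂μ, (t : ℝ) ≤ T) (n : ℕ)
    {w d e : Ω → ℝ} (hw : MemLp w ⊤ Q) (hd : Measurable d) (he : Measurable e) {R : ℝ}
    (heR : ∀ᵐ z ∂Q, |e z| ≤ R) {M s : ℝ} (hM : 0 < M) (hs : s ∈ Set.Icc 0 M)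
    (hpos : ∀ t ∈ Set.Icc 0 M, ∀ z, 0 ≤ d z + (t - s) * e z)
    (hzero : ∀ t ∈ Set.Icc 0 M, ∫ z, w z * laplaceMoment μ n (d z + (t - s) * e z) ∂Q = 0) :
    ∫ z, w z * (laplaceMoment μ (n + 1) (d z) * e z) ∂Q = 0 := by
  have hpos0 : ∀ z, 0 ≤ d z := fun z => by simpa using hpos s hs z
  have hzero0 : ∫ z, w z * laplaceMoment μ n (d z) ∂Q = 0 := by simpa using hzero s hs
  have heL : MemLp e ⊤ Q := memLp_top_of_bound he.aestronglyMeasurable R heR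
  set I := ∫ z, w z * (laplaceMoment μ (n + 1) (d z) * e z) ∂Q with hI
  set B := (∫ z, |w z| ∂Q) * (laplaceMoment μ (n + 2) 0 * R ^ 2) with hB
  have hB0 : 0 ≤ B := mul_nonneg (integral_nonneg fun z => abs_nonneg _)
    (mul_nonneg (laplaceMoment_nonneg _ _ _) (sq_nonneg _))
  -- The averages vanish at both `s` and `t`, so only the quadratic Taylor remainder is left to
  -- bound the linear term.
  have key : ∀ t ∈ Set.Icc 0 M, |t - s| * |I| ≤ |t - s| ^ 2 * B := by
    intro t ht
    have m1 := memLp_top_laplaceMoment (Q := Q) hT n hd hpos0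
    have m2 := memLp_top_laplaceMoment (Q := Q) hT n (d := fun z => d z + (t - s) * e z)
      (by fun_prop) (hpos t ht)
    have m3 := (memLp_top_laplaceMoment (Q := Q) hT (n + 1) hd hpos0).mul_top heL
    have m4 : MemLp (fun z => laplaceMoment μ n (d z + (t - s) * e z) -
        laplaceMoment μ n (d z)) ⊤ Q := m2.sub m1
    have h1 : (t - s) * I = ∫ z, w z * (laplaceMoment μ n (d z + (t - s) * e z) -
        laplaceMoment μ n (d z) + laplaceMoment μ (n + 1) (d z) * ((t - s) * e z)) ∂Q := by
      have e1 : ∀ z, w z * (laplaceMoment μ n (d z + (t - s) * e z) -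
          laplaceMoment μ n (d z) + laplaceMoment μ (n + 1) (d z) * ((t - s) * e z)) =
          w z * laplaceMoment μ n (d z + (t - s) * e z) - w z * laplaceMoment μ n (d z) +
            (t - s) * (w z * (laplaceMoment μ (n + 1) (d z) * e z)) := fun z => by ring
      simp only [e1]
      have i1 : Integrable (fun z => w z * laplaceMoment μ n (d z + (t - s) * e z) -
        w z * laplaceMoment μ n (d z)) Q :=
          (hw.mul_top m2).integrable_top.sub (hw.mul_top m1).integrable_top
      rw [integral_add i1 ((hw.mul_top m3).integrable_top.const_mul _),
        integral_sub (hw.mul_top m2).integrable_top (hw.mul_top m1).integrable_top, hzero t ht,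
        hzero0, integral_const_mul, sub_zero, zero_add]
    rw [← abs_mul, h1, hB, mul_left_comm, ← integral_mul_const, ← Real.norm_eq_abs]
    refine norm_integral_le_of_norm_le (hw.abs_top.integrable_top.mul_const _) ?_
    filter_upwards [heR] with z hz
    rw [norm_mul]
    refine mul_le_mul_of_nonneg_left ?_ (abs_nonneg _)
    have h2 := abs_laplaceMoment_sub_add_le hT n (hpos0 z) (hpos t ht z)
    rw [add_sub_cancel_left] at h2
    refine h2.trans ?_
    rw [mul_left_comm, mul_pow, sq_abs]
    have h3 : e z ^ 2 ≤ R ^ 2 := sq_le_sq' (abs_le.1 hz).1 (abs_le.1 hz).2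
    exact mul_le_mul_of_nonneg_left (mul_le_mul_of_nonneg_left h3 (sq_nonneg _))
      (laplaceMoment_nonneg _ _ _)
  have key2 : ∀ ε, 0 < ε → ε ≤ M / 2 → |I| ≤ ε * B := by
    intro ε hε hεM
    -- Move from `s` towards the farther end of the interval; this stays inside as `ε ≤ M / 2` and
    -- covers endpoints.
    obtain ⟨t, ht, hts⟩ : ∃ t ∈ Set.Icc 0 M, |t - s| = ε := by
      rcases le_total s (M / 2) with h | h
      · exact ⟨s + ε, ⟨by linarith [hs.1], by linarith⟩, by
          rw [add_sub_cancel_left, abs_of_pos hε]⟩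
      · exact ⟨s - ε, ⟨by linarith, by linarith [hs.2]⟩, by
          rw [sub_sub_cancel_left, abs_neg, abs_of_pos hε]⟩
    have h := key t ht
    rw [hts, sq, mul_assoc] at h
    exact le_of_mul_le_mul_left h hε
  by_contra hne
  have hI0 : 0 < |I| := abs_pos.2 hne
  have h1 := key2 (min (M / 2) (|I| / (2 * (B + 1)))) (by positivity) (min_le_left _ _)
  have h2 : min (M / 2) (|I| / (2 * (B + 1))) * B ≤ |I| / (2 * (B + 1)) * (B + 1) :=
    mul_le_mul (min_le_right _ _) (by linarith) hB0 (by positivity)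
  have h3 : |I| / (2 * (B + 1)) * (B + 1) = |I| / 2 := by field_simp
  linarith

/-- If all kernel averages of `Y` with weights in a box vanish, so do all moments. -/
theorem integral_mul_list_prod_eq_zero {ι : Type*} [Fintype ι] [DecidableEq ι] {Y : Ω → ℝ}
    {D : Ω → ι → ℝ} (hT : ∀ᵐ t : ℝ≥0 ∂μ, (t : ℝ) ≤ T) (hY : MemLp Y ⊤ Q) (hD : Measurable D)
    (hD0 : ∀ z i, 0 ≤ D z i) {R : ℝ} (hR : ∀ᵐ z ∂Q, ∀ i, |D z i| ≤ R) {M : ℝ} (hM : 0 < M)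
    (hpos : ∀ n, 0 < laplaceMoment μ n 0)
    (h : ∀ b : ι → ℝ, (∀ i, b i ∈ Set.Icc 0 M) →
      ∫ z, Y z * laplaceMoment μ 0 (∑ i, b i * D z i) ∂Q = 0) (l : List ι) :
    ∫ z, Y z * (l.map (D z)).prod ∂Q = 0 := by
  -- Each entry `j` of the list stands for one differentiation in `b j`. The claim must hold
  -- throughout the box, not only at `0`, to be differentiated again.
  have key : ∀ l : List ι, ∀ b : ι → ℝ, (∀ i, b i ∈ Set.Icc 0 M) →
      ∫ z, Y z * (l.map (D z)).prod * laplaceMoment μ l.length (∑ i, b i * D z i) ∂Q = 0 := by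
    intro l
    induction l with
    | nil => simpa using h
    | cons j l ih =>
      intro b hb
      have hupd : ∀ t z, ∑ i, b i * D z i + (t - b j) * D z j =
          ∑ i, Function.update b j t i * D z i := fun t z => by
        have hc : ∀ i ∈ Finset.univ.erase j, Function.update b j t i * D z i = b i * D z i :=
          fun i hi => by rw [Function.update_of_ne (Finset.ne_of_mem_erase hi)]
        rw [← Finset.add_sum_erase _ _ (Finset.mem_univ j),
          ← Finset.add_sum_erase _ (fun i => Function.update b j t i * D z i) (Finset.mem_univ j),
          Function.update_self, Finset.sum_congr rfl hc]
        ring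
      have hbt : ∀ t ∈ Set.Icc 0 M, ∀ i, Function.update b j t i ∈ Set.Icc 0 M := by
        intro t ht i
        by_cases hi : i = j
        · subst hi
          simpa using ht
        · simpa [Function.update_of_ne hi] using hb i
      have h1 := integral_mul_laplaceMoment_succ_eq_zero (Q := Q) hT l.length
        (w := fun z => Y z * (l.map (D z)).prod) (d := fun z => ∑ i, b i * D z i)
        (e := fun z => D z j) (hY.mul_top (memLp_top_list_prod hD hR l)) (by fun_prop)
        (by fun_prop) (hR.mono fun z hz => hz j) hM (hb j)
        (fun t ht z => by
          rw [hupd]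
          exact Finset.sum_nonneg fun i _ => mul_nonneg (hbt t ht i).1 (hD0 z i))
        (fun t ht => by
          simp only [hupd]
          exact ih _ (hbt t ht))
      rw [← h1]
      refine integral_congr_ae (.of_forall fun z => ?_)
      simp only [List.map_cons, List.prod_cons, List.length_cons]
      ring
  -- At zero weights the Laplace moment is a positive constant and can be divided out.
  have h0 := key l 0 fun i => ⟨le_rfl, hM.le⟩
  simp only [Pi.zero_apply, zero_mul, Finset.sum_const_zero] at h0
  rw [integral_mul_const] at h0
  exact (mul_eq_zero.1 h0).resolve_right (hpos _).ne'

end Moments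

variable {p : ℕ}

/-- If the response is centered on all events of `X_S`, then no feature carries signal. -/
theorem IsSufficient.isSufficient_empty {Q : Measure ((Fin p → ℝ) × ℝ)} [IsProbabilityMeasure Q]
    {S : Finset (Fin p)} (hS : IsSufficient Q S)
    (hY : MemLp (fun z : (Fin p → ℝ) × ℝ => z.2) ⊤ Q) (hcent : ∫ z, z.2 ∂Q = 0)
    (h : ∀ A : Set (S → ℝ), MeasurableSet A → ∫ z in subvector S ⁻¹' A, z.2 ∂Q = 0) :
    IsSufficient Q ∅ := by
  have h0 : (fun _ => (0 : ℝ)) =ᵐ[Q] Q[Prod.snd | subvectorSigma S] := by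
    refine ae_eq_condExp_of_forall_setIntegral_eq (measurable_subvector S).comap_le
      hY.integrable_top (fun s _ _ => (integrable_zero _ _ _).integrableOn) ?_
      aestronglyMeasurable_const
    rintro _ ⟨A, hA, rfl⟩ -
    rw [h A hA]
    simp
  have hconst : (subvector (∅ : Finset (Fin p))) = fun _ => default :=
    funext fun _ => Subsingleton.elim _ _
  refine ⟨?_, ?_⟩
  · refine hS.1.trans (h0.symm.trans (.of_eq ?_))
    -- The empty subvector generates the trivial `σ`-algebra, so its conditional expectation is
    -- `E[Y] = 0`.
    rw [hconst, MeasurableSpace.comap_const, condExp_bot, hcent]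
  · rw [hconst]
    exact indepFun_const_left _ _

/-! ### Detection of a nonempty signal set and the resulting gain. -/

section
variable {μ : Measure ℝ≥0} [IsFiniteMeasure μ] {q : ℕ} [hq : Fact (q = 1 ∨ q = 2)]
  {Q : Measure ((Fin p → ℝ) × ℝ)} [IsProbabilityMeasure Q] {C : ℝ}

/-- A nonempty signal set is detected by some function of the kernel space. -/
theorem exists_integral_response_ne_zero (hμ : KernelAssumption μ) (hC : CommonBound μ q Q C)
    (hQ : DistributionAssumption Q) {M : ℝ} (hM : 0 < M) {S : Finset (Fin p)}
    (hS : IsSignalSet Q S) (hne : S.Nonempty) :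
    ∃ β ∈ feasibleSet p M, (∀ j ∉ S, β j = 0) ∧
      ∃ f : KernelSpace μ q p, ∫ z, z.2 * f (rescale q β z.1) ∂Q ≠ 0 := by
  classical
  have hq0 : q ≠ 0 := by rcases hq.out with rfl | rfl <;> norm_num
  by_contra! hcon
  have hY := hC.memLp_response
  obtain ⟨A, _, hA⟩ := hQ.bounded
  set R := |A| with hR
  have hX : ∀ᵐ z ∂Q, ∀ i, 0 ≤ z.1 i + R ∧ z.1 i + R ≤ 2 * R := by
    filter_upwards [hA] with z hz i
    have h1 := abs_le.1 ((hz.1 i).trans (le_abs_self A))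
    constructor <;> linarith [h1.1, h1.2]
  -- Gaps to the point with all coordinates `-R`: since `X_i + R ≥ 0` almost surely, `D` determines
  -- `X_S`, also for `q = 2` where the sign would otherwise be lost.
  set D : (Fin p → ℝ) × ℝ → S → ℝ := fun z i => |z.1 i + R| ^ q with hD
  have hDm : Measurable D := by
    rw [measurable_pi_iff]
    intro i
    simp only [hD]
    fun_prop
  have hDb : ∀ᵐ z ∂Q, ∀ i, |D z i| ≤ (2 * R) ^ q := by
    filter_upwards [hX] with z hz i
    rw [abs_of_nonneg (by positivity)]
    refine pow_le_pow_left₀ (abs_nonneg _) ?_ q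
    rw [abs_of_nonneg (hz i).1]
    exact (hz i).2
  have hker : ∀ b : S → ℝ, (∀ i, b i ∈ Set.Icc 0 M) →
      ∫ z, z.2 * laplaceMoment μ 0 (∑ i, b i * D z i) ∂Q = 0 := by
    intro b hb
    set β : Fin p → ℝ := fun i => if h : i ∈ S then b ⟨i, h⟩ else 0 with hβ
    have hβS : ∀ j ∉ S, β j = 0 := fun j hj => by simp [hβ, hj]
    have hβb : ∀ i : S, β i = b i := fun i => by simp [hβ]
    have hβI : ∀ i, β i ∈ Set.Icc 0 M := fun i => by
      by_cases hi : i ∈ S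
      · rw [hβb ⟨i, hi⟩]
        exact hb _
      · rw [hβS i hi]
        exact ⟨le_rfl, hM.le⟩
    have hβD : β ∈ feasibleSet p M := by
      rw [feasibleSet_eq_pi]
      exact fun i _ => hβI i
    -- The section of the kernel at the rescaled base point is the test function whose values are
    -- `h(∑ b_i D_i)`.
    rw [← hcon β hβD hβS (kernelFeature μ q (rescale q β fun _ => -R))]
    refine integral_congr_ae (.of_forall fun z => ?_)
    simp only
    rw [kernelFeature_apply, laplaceMoment_zero]
    congr 2
    simp only [abs_rescale_sub_pow hq.out hβD.1]
    rw [← Finset.sum_subset (Finset.subset_univ S)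
      (fun i _ hi => by rw [hβS i hi, zero_mul]), ← Finset.sum_coe_sort S]
    refine Finset.sum_congr rfl fun i _ => ?_
    rw [hβb, ← abs_neg]
    simp only [hD]
    congr 3
    ring
  have hmom := integral_mul_list_prod_eq_zero hC.mass_bdd hY hDm
    (fun z i => by positivity) hDb hM (fun n => laplaceMoment_pos hμ n 0) hker
  have hzero : ∀ A : Set (S → ℝ), MeasurableSet A → ∫ z in subvector S ⁻¹' A, z.2 ∂Q = 0 := by
    intro A hA
    refine setIntegral_eq_zero_of_forall_boundedContinuous hY measurable_snd
      (measurable_subvector S) hC.response (fun F => ?_) hA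
    -- Composition with the inverse `u ↦ |u|^{1/q} - R` turns a function of `X_S` into a continuous
    -- function of `D`.
    have hF : Continuous fun u : S → ℝ => F fun i => |u i| ^ (1 / (q : ℝ)) - R := by
      refine F.continuous.comp (continuous_pi fun i => ?_)
      exact ((continuous_abs.comp (continuous_apply i)).rpow_const
        fun _ => Or.inr (by positivity)).sub continuous_const
    rw [← integral_mul_continuous_eq_zero hY hDm hDb hmom hF]
    refine integral_congr_ae ?_
    filter_upwards [hX] with z hz
    congr 2
    funext i
    simp only [hD, subvector]
    rw [abs_of_nonneg (by positivity : (0 : ℝ) ≤ |z.1 i + R| ^ q), one_div,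
      Real.pow_rpow_inv_natCast (abs_nonneg _) hq0, abs_of_nonneg (hz i).1]
    ring
  have hempty := hS.1.isSufficient_empty hY hQ.centered hzero
  have := hS.2 hempty (Finset.empty_subset S)
  exact hne.ne_empty (Finset.subset_empty.1 this)

/-- A function correlated with the response yields a uniform gain over the zero weights. -/
theorem exists_gain (hC : CommonBound μ q Q C) (hcent : ∫ z, z.2 ∂Q = 0) {β : Fin p → ℝ}
    (f : KernelSpace μ q p) (hf : ∫ z, z.2 * f (rescale q β z.1) ∂Q ≠ 0) :
    ∃ c₀ > 0, ∀ lam, 0 < lam → lam ≤ 1 →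
      c₀ < krrObjective μ q Q lam 0 - krrObjective μ q Q lam β := by
  have hY := hC.memLp_response
  have hfL : MemLp (fun z : (Fin p → ℝ) × ℝ => f (rescale q β z.1)) ⊤ Q := by
    have := memLp_top_inner_feature (Q := Q)
      (Φ := fun z : (Fin p → ℝ) × ℝ => kernelFeature μ q (rescale q β z.1))
      (fun z => (norm_kernelFeature _).le)
      (measurable_inner_kernelFeature hC.mass_bdd β) f
    simpa only [inner_kernelFeature] using this
  set b := ∫ z, z.2 * f (rescale q β z.1) ∂Q with hb
  set a := ∫ z, f (rescale q β z.1) * f (rescale q β z.1) ∂Q with ha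
  have ha0 : 0 ≤ a := integral_nonneg fun z => mul_self_nonneg _
  set A := a + ‖f‖ ^ 2 + 1 with hA
  have hA0 : 0 < A := by positivity
  -- The trial function `(b / A) f` gains at least `b² / (2 A)` for every `lam ≤ 1`; halving once
  -- more makes the inequality strict.
  refine ⟨b ^ 2 / (4 * A), by positivity, fun lam hlam hlam1 => ?_⟩
  rw [krrObjective_zero hC hlam hcent]
  set ε := b / A with hε
  have h1 := krrObjective_le Q hlam β (ε • f)
  have h2 : ∫ z, (z.2 - (ε • f) (rescale q β z.1)) ^ 2 ∂Q =
      ∫ z, z.2 * z.2 ∂Q - 2 * ε * b + ε ^ 2 * a := by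
    have i1 := (hY.mul_top hY).integrable_top
    have i2 := (hY.mul_top hfL).integrable_top.const_mul (2 * ε)
    have i3 := (hfL.mul_top hfL).integrable_top.const_mul (ε ^ 2)
    have i4 : Integrable (fun z : (Fin p → ℝ) × ℝ => z.2 * z.2 -
      2 * ε * (z.2 * f (rescale q β z.1))) Q := i1.sub i2
    rw [hb, ha, ← integral_const_mul, ← integral_const_mul, ← integral_sub i1 i2,
      ← integral_add i4 i3]
    refine integral_congr_ae (.of_forall fun z => ?_)
    simp only [RKHS.coe_smul, Pi.smul_apply, smul_eq_mul]
    ring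
  rw [h2, norm_smul, Real.norm_eq_abs, mul_pow, sq_abs] at h1
  have h3 : lam / 2 * (ε ^ 2 * ‖f‖ ^ 2) ≤ 1 / 2 * (ε ^ 2 * ‖f‖ ^ 2) := by gcongr
  have h4 : ε ^ 2 * a + ε ^ 2 * ‖f‖ ^ 2 ≤ ε ^ 2 * A := by
    have := sq_nonneg ε
    rw [hA]
    linarith
  have h5 : ε ^ 2 * A = b ^ 2 / A := by
    rw [hε]
    field_simp
  have h6 : ε * b = b ^ 2 / A := by
    rw [hε]
    ring
  have h7 : b ^ 2 / (4 * A) = b ^ 2 / A / 4 := by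
    field_simp
  have h8 : 0 < b ^ 2 / A := by positivity
  linarith

end

end SelfPen

/-! ### Choice of the constants. -/

theorem mainTheorem10 {p : ℕ} (q : ℕ) [Fact (q = 1 ∨ q = 2)]
    (μ : Measure ℝ≥0) [IsFiniteMeasure μ] (hμ : KernelAssumption μ)
    (Q : Measure ((Fin p → ℝ) × ℝ)) [IsProbabilityMeasure Q] (hQ : DistributionAssumption Q)
    (M : ℝ) (hM : 0 < M)
    (S : Finset (Fin p)) (hS : IsSignalSet Q S) (hne : S.Nonempty) :
    (∃ c₀ > 0, ∃ lam₀ > 0, ∀ c δ lam : ℝ, 0 < c → 0 < δ → 0 < lam → c ≤ c₀ → lam ≤ lam₀ →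
      (levelSet S (feasibleSet p M) (krrObjective μ q Q lam) c δ lam).Nonempty) ∧
    (∃ δ₀ > 0, ∀ c δ lam : ℝ, 0 < c → 0 < δ → 0 < lam → δ ≤ δ₀ → lam ≤ 1 →
      (levelSet S (feasibleSet p M) (krrObjective μ q Q lam) c δ lam).Nonempty →
      SelfPenalizing S (feasibleSet p M) (krrObjective μ q Q lam)
        (levelSet S (feasibleSet p M) (krrObjective μ q Q lam) c δ lam)) := by
  obtain ⟨C, hC⟩ := exists_commonBound hμ q hQ
  have hC1 := hC.one_le
  constructor
  · obtain ⟨β, hβ, hβS, f, hf⟩ := exists_integral_response_ne_zero hμ hC hQ hM hS hne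
    obtain ⟨c₀, hc₀, hgain⟩ := exists_gain hC hQ.centered f hf
    -- One point serves for all `c`, `δ` and `lam`: it is carried by `S`, so the constraint off `S`
    -- is trivial.
    refine ⟨c₀, hc₀, 1, one_pos, fun c δ lam hc hδ hlam hcc hlam1 => ⟨β, hβ, ?_, ?_⟩⟩
    · exact hcc.trans_lt (hgain lam hlam hlam1)
    · rw [Finset.sum_eq_zero fun j hj => by rw [hβS j (Finset.mem_compl.1 hj), abs_zero]]
      positivity
  · have hq0 : q ≠ 0 := by
      rcases (Fact.out : q = 1 ∨ q = 2) with rfl | rfl <;> norm_num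
    obtain ⟨m, T, hm0, hmT⟩ := hμ.ae_mem
    have hne' : Nonempty (Fin p) := ⟨hne.choose⟩
    obtain ⟨j₀, hj₀⟩ := Finite.exists_min fun j : Fin p => ∫ w, coordGap q j w ∂(Q.prod Q)
    set v := ∫ w, coordGap q j₀ w ∂(Q.prod Q) with hv
    have hv0 : 0 < v := integral_coordGap_pos hq0 (hC.memLp_coordGap j₀) (hQ.variance_pos j₀)
    -- The two terms are the two smallness conditions on `δ`, solved for `δ`; neither involves `c`
    -- or `lam`.
    refine ⟨min (1 / (2 * C ^ 6)) (m * v / (8 * C ^ 9)), by positivity,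
      fun c δ lam hc hδ hlam hδδ hlam1 hB => ?_⟩
    refine selfPenalizing_levelSet hM hC hQ.centered hS.1 hm0 (hmT.mono fun t ht => ht.1) hv0 hj₀
      hc hδ hlam hlam1 ?_ ?_ hB
    · have h := hδδ.trans (min_le_left _ _)
      rw [le_div_iff₀ (by positivity)] at h
      linarith
    · have h := hδδ.trans (min_le_right _ _)
      rw [le_div_iff₀ (by positivity)] at h
      linarith
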